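/- Let $X$ be a compact metric space with a continuous flow $\phi:\mathbb R\curvearrowright X$ which is free (no periodic points) and minimal (every forward orbit is dense). A compact set $B\subset X$ is a flowbox of length $l>0$ if for every $x\in B$ there are $a_-(x)\le 0\le a_+(x)$ and $\epsilon(x)>0$ with $l=a_+(x)-a_-(x)$, $\phi_t(x)\in B$ for $t\in[a_-(x),a_+(x)]$ and $\phi_t(x)\notin B$ for $t\in(a_-(x)-\epsilon(x),a_-(x))\cup(a_+(x),a_+(x)+\epsilon(x))$; its central slice is $S_B=\{x\in B: a_-(x)+a_+(x)=0\}$. Write $\phi(S\times I)=\{\phi_t(y):y\in S,\ t\in I\}$. A flowbox structure around $\bar x\in X$ is a sequence $\mathfrak B=\{B_n\}_{n\in\mathbb N}$ of flowboxes with non-empty interior, with lengths $l_n$ and central slices $S_n$, such that 1. $S_{n+1}\subset S_n\cap B_n^\circ$ for all $n$; 2. for every $L>0$ there is $N$ such that $l_n>L$ for all $n>N$; 3. $S_n$ is contained in the open ball of radius $1/n$ around $\bar x$ for all $n\ge1$; 4. $\phi(S_n\times[-l/2,l/2])$ has non-empty interior for all $n$ and $0<l\le l_n$; 5. for all $n$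 and $0<\eta<l_n/2$ there is $k>n$ such that $\phi(S_k\times[L_1,L_2])\subset(\phi(S_n\times[L_1-\eta,L_2+\eta]))^\circ$ for all $L_1\le L_2$ with $-l_n/2<L_1-\eta$ and $L_2+\eta<l_n/2$. It is a Cantor flowbox structure if there is a flowbox $B$ with non-empty interior whose central slice $S$ is a Cantor space such that every $S_n$ is a clopen subset of $S$ and $S_n\subset S\cap B^\circ$. Let $C(X)\rtimes\mathbb R$ be the crossed product by the action $\alpha_s(h)=h\circ\phi_{-s}$, that is, the completion of the convolution $*$-algebra $C_c(\mathbb R,C(X))$ in the universal norm. Let $$\mathcal A_n(\mathfrak B)=\{a\in C_c(\mathbb R,C(X)) : a(s)(\phi_t(y))=0\ \text{ whenever } y\in S_n \text{ and } 0\le t\le s \text{ or } s\le t\le 0\},$$ and let $A_n(\mathfrak B)$ be the closure of $\mathcal A_n(\mathfrak B)$ in $C(X)\rtimes\mathbb R$. Let $\mathbb K$ be the $C^*$-algebra of compact operators on $L^2([0,1])$. **Proposition.** Let $\mathfrak B$ be a Cantor flowbox structure around a point $\bar x\in X$ and let $n\in\mathbb N$. Then for every $y\in S_n$ the return time $\tau_{S_n}(y)=\min\{t>0:\phi_t(y)\in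 S_n\}$ exists, and there is an isometric $*$-isomorphism $\pi_n:A_n(\mathfrak B)\to C(S_n,\mathbb K)$, where $C(S_n,\mathbb K)$ carries the supremum norm, such that for every $f\in\mathcal A_n(\mathfrak B)$, $y\in S_n$ and $\xi\in L^2([0,1])$, for almost every $t\in[0,1]$, $$(\pi_n(f)(y)\,\xi)(t)=\int_0^1\tau_{S_n}(y)\,f\big(\tau_{S_n}(y)(t-s)\big)\big(\phi_{\tau_{S_n}(y)t}(y)\big)\,\xi(s)\,ds.$$ -/

import Mathlib

open MeasureTheory Set
open scoped CompactlySupported ENNReal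

universe u

set_option linter.unusedSectionVars false

namespace FlowAlg

/-! ### Flows, flowboxes and flowbox structures -/

section Flows

variable {X : Type u} [TopologicalSpace X]

/-- A flow is free if it has no periodic points. -/
def IsFree (φ : Flow ℝ X) : Prop :=
  ∀ (x : X) (t : ℝ), φ t x = x → t = 0

/-- A flow is minimal if the forward orbit of every point is dense. -/
def IsMinimal (φ : Flow ℝ X) : Prop :=
  ∀ x : X, Dense ((fun t : ℝ => φ t x) '' Ici 0)

/-- The numbers `a ≤ 0 ≤ b` are the entrance and exit times of the point `x` for the set `B`
and the length `l`: `b - a = l`, the orbit of `x` is in `B` during `[a, b]`, and it is outside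
`B` shortly before `a` and shortly after `b`. -/
def IsBoxTime (φ : Flow ℝ X) (B : Set X) (l : ℝ) (x : X) (a b : ℝ) : Prop :=
  a ≤ 0 ∧ 0 ≤ b ∧ l = b - a ∧ (∀ t ∈ Icc a b, φ t x ∈ B) ∧
    ∃ ε : ℝ, 0 < ε ∧ ∀ t ∈ Ioo (a - ε) a ∪ Ioo b (b + ε), φ t x ∉ B

/-- `B` is a flowbox of length `l`. -/
def IsFlowbox (φ : Flow ℝ X) (B : Set X) (l : ℝ) : Prop :=
  IsCompact B ∧ 0 < l ∧ ∀ x ∈ B, ∃ a b : ℝ, IsBoxTime φ B l x a b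

/-- The central slice of a flowbox `B` of length `l`. -/
def centralSlice (φ : Flow ℝ X) (B : Set X) (l : ℝ) : Set X :=
  {x | x ∈ B ∧ ∃ a b : ℝ, IsBoxTime φ B l x a b ∧ a + b = 0}

/-- The set `φ (S × [a, b])`. -/
def flowImage (φ : Flow ℝ X) (S : Set X) (a b : ℝ) : Set X :=
  {x | ∃ y ∈ S, ∃ t ∈ Icc a b, φ t y = x}

/-- The subset `S`, with its subspace topology, is a Cantor space. -/
def IsCantorSet (S : Set X) : Prop := Nonempty (S ≃ₜ (ℕ → Bool))

/-- The first arrive time `min {t > 0 | φ_t(x) ∈ S}`. -/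
noncomputable def arriveTime (φ : Flow ℝ X) (S : Set X) (x : X) : ℝ :=
  sInf {t : ℝ | 0 < t ∧ φ t x ∈ S}

end Flows

/-- A flowbox structure around the point `x`: a sequence of flowboxes `B n` of lengths `l n`, with
non-empty interiors and central slices `S n`, which shrink to `x` while their lengths diverge. -/
structure FlowboxStructure {X : Type u} [MetricSpace X] (φ : Flow ℝ X) (x : X) where
  /-- the boxes -/
  B : ℕ → Set X
  /-- their lengths -/
  l : ℕ → ℝ
  isFlowbox : ∀ n, IsFlowbox φ (B n) (l n)
  nonempty_interior : ∀ n, (interior (B n)).Nonempty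
  slice_subset : ∀ n, centralSlice φ (B (n + 1)) (l (n + 1)) ⊆
    centralSlice φ (B n) (l n) ∩ interior (B n)
  length_diverges : ∀ L : ℝ, 0 < L → ∃ N : ℕ, ∀ n > N, L < l n
  slice_subset_ball : ∀ n ≥ 1, centralSlice φ (B n) (l n) ⊆ Metric.ball x (1 / (n : ℝ))
  nonempty_interior_subbox : ∀ n, ∀ l' : ℝ, 0 < l' → l' ≤ l n →
    (interior (flowImage φ (centralSlice φ (B n) (l n)) (-l' / 2) (l' / 2))).Nonempty
  subset_interior : ∀ n, ∀ η : ℝ, 0 < η → η < l n / 2 → ∃ k > n, ∀ L₁ L₂ : ℝ, L₁ ≤ L₂ →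
    -l n / 2 < L₁ - η → L₂ + η < l n / 2 →
    flowImage φ (centralSlice φ (B k) (l k)) L₁ L₂ ⊆
      interior (flowImage φ (centralSlice φ (B n) (l n)) (L₁ - η) (L₂ + η))

namespace FlowboxStructure

variable {X : Type u} [MetricSpace X] {φ : Flow ℝ X} {x : X}

/-- The central slice `S n` of the `n`-th box. -/
def S (𝔅 : FlowboxStructure φ x) (n : ℕ) : Set X := centralSlice φ (𝔅.B n) (𝔅.l n)

/-- A flowbox structure is a Cantor flowbox structure if all its slices are clopen subsets of one
Cantor central slice of a flowbox with non-empty interior, and lie in the interior of that box. -/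
def IsCantor (𝔅 : FlowboxStructure φ x) : Prop :=
  ∃ (B : Set X) (l : ℝ), IsFlowbox φ B l ∧ (interior B).Nonempty ∧
    IsCantorSet (centralSlice φ B l) ∧
    ∀ n, 𝔅.S n ⊆ centralSlice φ B l ∩ interior B ∧
      IsClopen ((↑) ⁻¹' 𝔅.S n : Set (centralSlice φ B l))

end FlowboxStructure

/-! ### The convolution algebra `C_c(ℝ, C(X))` -/

section Convolution

variable {X : Type u} [TopologicalSpace X]

/-- The homeomorphism `φ_s` as a continuous map. -/
def flowMap (φ : Flow ℝ X) (s : ℝ) : C(X, X) :=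
  ⟨φ s, φ.continuous continuous_const continuous_id⟩

/-- The action of `ℝ` on `C(X)`: `α_s(h)(x) = h(φ_{-s}(x))`. -/
noncomputable def act (φ : Flow ℝ X) (s : ℝ) (h : C(X, ℂ)) : C(X, ℂ) := h.comp (flowMap φ (-s))

@[simp] theorem act_apply (φ : Flow ℝ X) (s : ℝ) (h : C(X, ℂ)) (x : X) :
    act φ s h x = h (φ (-s) x) := rfl

theorem continuous_act [LocallyCompactSpace X] (φ : Flow ℝ X) {Y : Type*} [TopologicalSpace Y]
    {s : Y → ℝ} {h : Y → C(X, ℂ)} (hs : Continuous s) (hh : Continuous h) :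
    Continuous fun y => act φ (s y) (h y) := by
  refine ContinuousMap.continuous_of_continuous_uncurry _ ?_
  have h1 : Continuous fun p : Y × X => φ (-s p.1) p.2 :=
    φ.continuous (hs.comp continuous_fst).neg continuous_snd
  exact continuous_eval.comp ((hh.comp continuous_fst).prodMk h1)

theorem act_zero (φ : Flow ℝ X) (s : ℝ) : act φ s 0 = 0 := rfl

theorem hasCompactSupport_cc (f : C_c(ℝ, C(X, ℂ))) : HasCompactSupport f := f.hasCompactSupport'

theorem continuous_cc (f : C_c(ℝ, C(X, ℂ))) : Continuous f := map_continuous f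

theorem cc_eq_zero {f : C_c(ℝ, C(X, ℂ))} {s : ℝ} (h : s ∉ tsupport f) : f s = 0 :=
  image_eq_zero_of_notMem_tsupport h

variable [CompactSpace X] [T2Space X]

theorem continuous_convIntegrand (φ : Flow ℝ X) (f g : C_c(ℝ, C(X, ℂ))) :
    Continuous fun p : ℝ × ℝ => f p.2 * act φ p.2 (g (p.1 - p.2)) :=
  ((continuous_cc f).comp continuous_snd).mul
    (continuous_act φ continuous_snd ((continuous_cc g).comp (continuous_fst.sub continuous_snd)))

/-- The convolution product
`(f * g)(s) = ∫ f(r) α_r(g(s - r)) dr` of `C_c(ℝ, C(X))`. -/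
noncomputable def conv (φ : Flow ℝ X) (f g : C_c(ℝ, C(X, ℂ))) : C_c(ℝ, C(X, ℂ)) where
  toFun s := ∫ r, f r * act φ r (g (s - r))
  continuous_toFun := by
    have h := continuous_parametric_integral_of_continuous (μ := (volume : Measure ℝ))
      (f := fun s r => f r * act φ r (g (s - r))) (continuous_convIntegrand φ f g)
      (s := tsupport f) (hasCompactSupport_cc f)
    refine h.congr fun s => setIntegral_eq_integral_of_forall_compl_eq_zero fun r hr => ?_
    rw [cc_eq_zero hr, zero_mul]
  hasCompactSupport' := by
    refine HasCompactSupport.intro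
      ((hasCompactSupport_cc f).isCompact.add (hasCompactSupport_cc g).isCompact) fun s hs => ?_
    refine integral_eq_zero_of_ae (Filter.Eventually.of_forall fun r => ?_)
    by_cases hr : r ∈ tsupport f
    · have : s - r ∉ tsupport g := fun h => hs ⟨r, hr, s - r, h, by simp⟩
      simp [cc_eq_zero this, act_zero]
    · simp [cc_eq_zero hr]

theorem conv_apply (φ : Flow ℝ X) (f g : C_c(ℝ, C(X, ℂ))) (s : ℝ) :
    conv φ f g s = ∫ r, f r * act φ r (g (s - r)) := rfl

theorem hasCompactSupport_convIntegrand (φ : Flow ℝ X) (f g : C_c(ℝ, C(X, ℂ))) (s : ℝ) :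
    HasCompactSupport fun r => f r * act φ r (g (s - r)) := by
  refine HasCompactSupport.intro (hasCompactSupport_cc f) fun r hr => ?_
  rw [cc_eq_zero hr, zero_mul]

theorem integrable_convIntegrand (φ : Flow ℝ X) (f g : C_c(ℝ, C(X, ℂ))) (s : ℝ) :
    Integrable fun r => f r * act φ r (g (s - r)) :=
  ((continuous_convIntegrand φ f g).comp (Continuous.prodMk_right s)).integrable_of_hasCompactSupport
    (hasCompactSupport_convIntegrand φ f g s)

theorem conv_apply_apply (φ : Flow ℝ X) (f g : C_c(ℝ, C(X, ℂ))) (s : ℝ) (x : X) :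
    conv φ f g s x = ∫ r, f r x * g (s - r) (φ (-r) x) :=
  ((ContinuousMap.evalCLM ℂ x).integral_comp_comm (integrable_convIntegrand φ f g s)).symm

/-- The involution `f^*(s) = α_s(f(-s)^*)` of `C_c(ℝ, C(X))`. -/
noncomputable def invol (φ : Flow ℝ X) (f : C_c(ℝ, C(X, ℂ))) : C_c(ℝ, C(X, ℂ)) where
  toFun s := act φ s (star (f (-s)))
  continuous_toFun :=
    continuous_act φ continuous_id (((continuous_cc f).comp continuous_neg).star)
  hasCompactSupport' := by
    refine HasCompactSupport.intro (hasCompactSupport_cc f).isCompact.neg fun s hs => ?_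
    have : -s ∉ tsupport f := hs
    rw [cc_eq_zero this, star_zero, act_zero]

theorem invol_apply (φ : Flow ℝ X) (f : C_c(ℝ, C(X, ℂ))) (s : ℝ) :
    invol φ f s = act φ s (star (f (-s))) := rfl

end Convolution

/-! ### Covariant representations and the crossed product `C(X) ⋊ ℝ` -/

section CrossedProduct

variable {X : Type u} [TopologicalSpace X] [CompactSpace X] [T2Space X]

/-- A covariant representation of the `C^*`-dynamical system `(C(X), ℝ, α)`: a unital
`*`-representation of `C(X)` and a strongly continuous unitary representation of `ℝ` on a Hilbert
space, with `U_s π(h) U_s^* = π(α_s(h))`. -/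
structure CovariantRep (φ : Flow ℝ X) where
  /-- the Hilbert space -/
  H : Type u
  [normedAddCommGroup : NormedAddCommGroup H]
  [innerProductSpace : InnerProductSpace ℂ H]
  [completeSpace : CompleteSpace H]
  /-- the representation of `C(X)` -/
  π : C(X, ℂ) →⋆ₐ[ℂ] (H →L[ℂ] H)
  /-- the representation of `ℝ` -/
  U : ℝ → H ≃ₗᵢ[ℂ] H
  U_add : ∀ s t ξ, U (s + t) ξ = U s (U t ξ)
  continuous_U : ∀ ξ, Continuous fun s => U s ξ
  covariant : ∀ s h ξ, U s (π h ξ) = π (act φ s h) (U s ξ)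

attribute [instance] CovariantRep.normedAddCommGroup CovariantRep.innerProductSpace
  CovariantRep.completeSpace

namespace CovariantRep

variable {φ : Flow ℝ X} (ρ : CovariantRep φ)

theorem norm_π_le (h : C(X, ℂ)) : ‖ρ.π h‖ ≤ ‖h‖ := NonUnitalStarAlgHom.norm_apply_le ρ.π h

theorem continuous_π : Continuous ρ.π :=
  AddMonoidHomClass.continuous_of_bound ρ.π 1 (by simpa using ρ.norm_π_le)

theorem U_zero (ξ : ρ.H) : ρ.U 0 ξ = ξ := by
  have h := ρ.U_add 0 0 ξ
  rw [add_zero] at h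
  exact ((ρ.U 0).injective h).symm

theorem continuous_integrand (f : C_c(ℝ, C(X, ℂ))) (ξ : ρ.H) :
    Continuous fun s => ρ.π (f s) (ρ.U s ξ) :=
  (ρ.continuous_π.comp (continuous_cc f)).clm_apply (ρ.continuous_U ξ)

theorem integrable_integrand (f : C_c(ℝ, C(X, ℂ))) (ξ : ρ.H) :
    Integrable fun s => ρ.π (f s) (ρ.U s ξ) := by
  refine (ρ.continuous_integrand f ξ).integrable_of_hasCompactSupport ?_
  refine HasCompactSupport.intro (hasCompactSupport_cc f) fun s hs => ?_
  rw [cc_eq_zero hs, map_zero, _root_.zero_apply]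

theorem norm_integral_le (f : C_c(ℝ, C(X, ℂ))) (ξ : ρ.H) :
    ‖∫ s, ρ.π (f s) (ρ.U s ξ)‖ ≤ (∫ s, ‖f s‖) * ‖ξ‖ := by
  rw [← integral_mul_const]
  refine norm_integral_le_of_norm_le ?_ (Filter.Eventually.of_forall fun s => ?_)
  · exact (((continuous_cc f).norm).integrable_of_hasCompactSupport
      (hasCompactSupport_cc f).norm).mul_const _
  · calc ‖ρ.π (f s) (ρ.U s ξ)‖ ≤ ‖ρ.π (f s)‖ * ‖ρ.U s ξ‖ := ContinuousLinearMap.le_opNorm _ _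
      _ ≤ ‖f s‖ * ‖ξ‖ := by
        rw [LinearIsometryEquiv.norm_map]
        gcongr
        exact ρ.norm_π_le _

/-- The integrated form `(π ⋊ U)(f) = ∫ π(f(s)) U_s ds` of a covariant representation. -/
noncomputable def integrated (f : C_c(ℝ, C(X, ℂ))) : ρ.H →L[ℂ] ρ.H :=
  LinearMap.mkContinuous
    { toFun := fun ξ => ∫ s, ρ.π (f s) (ρ.U s ξ)
      map_add' := fun ξ η => by
        simp only [map_add]
        exact integral_add (ρ.integrable_integrand f ξ) (ρ.integrable_integrand f η)
      map_smul' := fun c ξ => by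
        simp only [map_smul, RingHom.id_apply]
        exact integral_smul c _ }
    (∫ s, ‖f s‖) (ρ.norm_integral_le f)

theorem integrated_apply (f : C_c(ℝ, C(X, ℂ))) (ξ : ρ.H) :
    ρ.integrated f ξ = ∫ s, ρ.π (f s) (ρ.U s ξ) := rfl

theorem norm_integrated_le (f : C_c(ℝ, C(X, ℂ))) : ‖ρ.integrated f‖ ≤ ∫ s, ‖f s‖ :=
  LinearMap.mkContinuous_norm_le _ (integral_nonneg fun _ => norm_nonneg _) _

theorem integrated_add (f g : C_c(ℝ, C(X, ℂ))) :
    ρ.integrated (f + g) = ρ.integrated f + ρ.integrated g := by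
  ext ξ
  simp only [integrated_apply, _root_.add_apply,
    CompactlySupportedContinuousMap.add_apply, map_add]
  exact integral_add (ρ.integrable_integrand f ξ) (ρ.integrable_integrand g ξ)

theorem integrated_smul (c : ℂ) (f : C_c(ℝ, C(X, ℂ))) :
    ρ.integrated (c • f) = c • ρ.integrated f := by
  ext ξ
  simp only [integrated_apply, _root_.smul_apply,
    CompactlySupportedContinuousMap.smul_apply, map_smul]
  exact integral_smul c _

theorem integrated_conv (f g : C_c(ℝ, C(X, ℂ))) :
    ρ.integrated (conv φ f g) = ρ.integrated f * ρ.integrated g := by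
  ext ξ
  rw [mul_apply_eq_comp, integrated_apply, integrated_apply]
  have hcont : Continuous fun p : ℝ × ℝ =>
      ρ.π (f p.2 * act φ p.2 (g (p.1 - p.2))) (ρ.U p.1 ξ) :=
    (ρ.continuous_π.comp (continuous_convIntegrand φ f g)).clm_apply
      ((ρ.continuous_U ξ).comp continuous_fst)
  have hsupp : HasCompactSupport fun p : ℝ × ℝ =>
      ρ.π (f p.2 * act φ p.2 (g (p.1 - p.2))) (ρ.U p.1 ξ) := by
    refine HasCompactSupport.intro (((hasCompactSupport_cc f).isCompact.add (hasCompactSupport_cc g).isCompact).prod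
      (hasCompactSupport_cc f)) ?_
    rintro ⟨s, r⟩ hp
    by_cases hr : r ∈ tsupport f
    · have : s - r ∉ tsupport g := fun h => hp ⟨⟨r, hr, s - r, h, by simp⟩, hr⟩
      simp [cc_eq_zero this, act_zero]
    · simp [cc_eq_zero hr]
  calc ∫ s, ρ.π (conv φ f g s) (ρ.U s ξ)
      = ∫ s, ∫ r, ρ.π (f r * act φ r (g (s - r))) (ρ.U s ξ) := by
        refine integral_congr_ae (Filter.Eventually.of_forall fun s => ?_)
        let L : C(X, ℂ) →L[ℂ] ρ.H :=
          LinearMap.mkContinuous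
            { toFun := fun h => ρ.π h (ρ.U s ξ)
              map_add' := fun h k => by simp
              map_smul' := fun c h => by simp } ‖ρ.U s ξ‖ (fun h => by
                rw [mul_comm]
                exact (ContinuousLinearMap.le_opNorm _ _).trans
                  (mul_le_mul_of_nonneg_right (ρ.norm_π_le h) (norm_nonneg _)))
        exact (L.integral_comp_comm (integrable_convIntegrand φ f g s)).symm
    _ = ∫ r, ∫ s, ρ.π (f r * act φ r (g (s - r))) (ρ.U s ξ) :=
        integral_integral_swap_of_hasCompactSupport (f := fun s r =>
          ρ.π (f r * act φ r (g (s - r))) (ρ.U s ξ)) hcont hsupp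
    _ = ∫ r, ρ.π (f r) (ρ.U r (∫ s, ρ.π (g s) (ρ.U s ξ))) := by
        refine integral_congr_ae (Filter.Eventually.of_forall fun r => ?_)
        have h1 : ∀ s, ρ.π (f r * act φ r (g (s - r))) (ρ.U s ξ) =
            ((ρ.π (f r)).comp (ρ.U r : ρ.H →L[ℂ] ρ.H)) (ρ.π (g (s - r)) (ρ.U (s - r) ξ)) := by
          intro s
          have h2 : ρ.U s ξ = ρ.U r (ρ.U (s - r) ξ) := by rw [← ρ.U_add]; simp
          rw [h2, map_mul, mul_apply_eq_comp, ← ρ.covariant]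
          rfl
        simp only [h1]
        rw [integral_sub_right_eq_self (fun s =>
          ((ρ.π (f r)).comp (ρ.U r : ρ.H →L[ℂ] ρ.H)) (ρ.π (g s) (ρ.U s ξ))) r]
        exact ((ρ.π (f r)).comp (ρ.U r : ρ.H →L[ℂ] ρ.H)).integral_comp_comm
          (ρ.integrable_integrand g ξ)

theorem integrated_invol (f : C_c(ℝ, C(X, ℂ))) :
    ρ.integrated (invol φ f) = star (ρ.integrated f) := by
  rw [ContinuousLinearMap.star_eq_adjoint, ContinuousLinearMap.eq_adjoint_iff]
  intro ξ η
  rw [integrated_apply, integrated_apply]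
  rw [← integral_inner (ρ.integrable_integrand f η) ξ]
  have h0 : inner ℂ (∫ s, ρ.π (invol φ f s) (ρ.U s ξ)) η =
      ∫ s, inner ℂ (ρ.π (invol φ f s) (ρ.U s ξ)) η := by
    rw [← inner_conj_symm, ← integral_inner (ρ.integrable_integrand _ ξ) η, ← integral_conj]
    simp only [inner_conj_symm]
  rw [h0, ← integral_neg_eq_self]
  refine integral_congr_ae (Filter.Eventually.of_forall fun s => ?_)
  have h1 : ρ.π (invol φ f (-s)) (ρ.U (-s) ξ) = ρ.U (-s) (ρ.π (star (f s)) ξ) := by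
    rw [invol_apply, neg_neg, ρ.covariant]
  have h2 : inner ℂ (ρ.U (-s) (ρ.π (star (f s)) ξ)) η =
      inner ℂ (ρ.π (star (f s)) ξ) (ρ.U s η) := by
    rw [← (ρ.U s).inner_map_map, ← ρ.U_add, add_neg_cancel, ρ.U_zero]
  simp only [h1, h2]
  rw [map_star, ContinuousLinearMap.star_eq_adjoint, ContinuousLinearMap.adjoint_inner_left]

end CovariantRep

/-- The product (in the sense of `C^*`-algebras, that is with uniformly bounded norms) of the
algebras `B(H_ρ)`, where `ρ` ranges over all covariant representations. -/
def UniversalProduct (φ : Flow ℝ X) : Type (u + 1) :=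
  lp (fun ρ : CovariantRep φ => ρ.H →L[ℂ] ρ.H) ∞

noncomputable instance instUniversalProduct (φ : Flow ℝ X) :
    NonUnitalCStarAlgebra (UniversalProduct φ) :=
  inferInstanceAs (NonUnitalCStarAlgebra (lp (fun ρ : CovariantRep φ => ρ.H →L[ℂ] ρ.H) ∞))

/-- The universal representation of `C_c(ℝ, C(X))`: its component at a covariant representation is
the integrated form, so that `‖universalRep φ f‖ = sup_ρ ‖ρ(f)‖` is the universal norm of `f`. -/
noncomputable def universalRep (φ : Flow ℝ X) (f : C_c(ℝ, C(X, ℂ))) : UniversalProduct φ :=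
  ⟨fun ρ => ρ.integrated f, memℓp_infty ⟨∫ s, ‖f s‖, by
    rintro _ ⟨ρ, rfl⟩
    exact ρ.norm_integrated_le f⟩⟩

theorem universalRep_add (φ : Flow ℝ X) (f g : C_c(ℝ, C(X, ℂ))) :
    universalRep φ (f + g) = universalRep φ f + universalRep φ g :=
  lp.ext (funext fun ρ => ρ.integrated_add f g)

theorem universalRep_smul (φ : Flow ℝ X) (c : ℂ) (f : C_c(ℝ, C(X, ℂ))) :
    universalRep φ (c • f) = c • universalRep φ f :=
  lp.ext (funext fun ρ => ρ.integrated_smul c f)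

theorem universalRep_conv (φ : Flow ℝ X) (f g : C_c(ℝ, C(X, ℂ))) :
    universalRep φ (conv φ f g) = universalRep φ f * universalRep φ g :=
  lp.ext (funext fun ρ => ρ.integrated_conv f g)

theorem universalRep_invol (φ : Flow ℝ X) (f : C_c(ℝ, C(X, ℂ))) :
    universalRep φ (invol φ f) = star (universalRep φ f) :=
  lp.ext (funext fun ρ => ρ.integrated_invol f)

theorem universalRep_zero (φ : Flow ℝ X) : universalRep φ 0 = 0 := by
  simpa using universalRep_smul φ 0 0

/-- The image of `C_c(ℝ, C(X))` in the universal representation. -/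
noncomputable def universalImage (φ : Flow ℝ X) : NonUnitalStarSubalgebra ℂ (UniversalProduct φ) where
  carrier := range (universalRep φ)
  add_mem' := by
    rintro _ _ ⟨f, rfl⟩ ⟨g, rfl⟩
    exact ⟨f + g, universalRep_add φ f g⟩
  zero_mem' := ⟨0, universalRep_zero φ⟩
  mul_mem' := by
    rintro _ _ ⟨f, rfl⟩ ⟨g, rfl⟩
    exact ⟨conv φ f g, universalRep_conv φ f g⟩
  smul_mem' := by
    rintro c _ ⟨f, rfl⟩
    exact ⟨c • f, universalRep_smul φ c f⟩
  star_mem' := by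
    rintro _ ⟨f, rfl⟩
    exact ⟨invol φ f, universalRep_invol φ f⟩

/-- The (full) crossed product `C(X) ⋊ ℝ`: the completion of `C_c(ℝ, C(X))` in the universal norm
`‖f‖ = sup_ρ ‖ρ(f)‖`, realized as the closure of the image of the universal representation. -/
def CrossedProduct (φ : Flow ℝ X) : Type (u + 1) :=
  (universalImage φ).topologicalClosure

noncomputable instance instCrossedProduct (φ : Flow ℝ X) :
    NonUnitalCStarAlgebra (CrossedProduct φ) :=
  NonUnitalStarSubalgebra.nonUnitalCStarAlgebra (universalImage φ).topologicalClosure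
    (h_closed := NonUnitalStarSubalgebra.isClosed_topologicalClosure _)

/-- The canonical map `C_c(ℝ, C(X)) → C(X) ⋊ ℝ`. -/
noncomputable def toCrossedProduct (φ : Flow ℝ X) (f : C_c(ℝ, C(X, ℂ))) : CrossedProduct φ :=
  ⟨universalRep φ f, NonUnitalStarSubalgebra.le_topologicalClosure _ ⟨f, rfl⟩⟩

/-! ### The building blocks -/

/-- The set of all `a ∈ C_c(ℝ, C(X))` with `a(s)(φ_t(y)) = 0` whenever `y ∈ S` and
`0 ≤ t ≤ s` or `s ≤ t ≤ 0`. -/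
def blockFunctions (φ : Flow ℝ X) (S : Set X) : Set C_c(ℝ, C(X, ℂ)) :=
  {a | ∀ (x : X) (s : ℝ),
    (∃ y ∈ S, ∃ t : ℝ, x = φ t y ∧ (0 ≤ t ∧ t ≤ s ∨ s ≤ t ∧ t ≤ 0)) → a s x = 0}

theorem conv_mem_blockFunctions {φ : Flow ℝ X} {S : Set X} {f g : C_c(ℝ, C(X, ℂ))}
    (hf : f ∈ blockFunctions φ S) (hg : g ∈ blockFunctions φ S) :
    conv φ f g ∈ blockFunctions φ S := by
  rintro x s ⟨y, hy, t, rfl, ht⟩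
  rw [conv_apply_apply]
  refine integral_eq_zero_of_ae (Filter.Eventually.of_forall fun r => ?_)
  simp only [Pi.zero_apply, mul_eq_zero]
  by_cases h : 0 ≤ t ∧ t ≤ r ∨ r ≤ t ∧ t ≤ 0
  · exact Or.inl (hf _ _ ⟨y, hy, t, rfl, h⟩)
  · refine Or.inr (hg _ _ ⟨y, hy, t - r, ?_, ?_⟩)
    · rw [← φ.map_add]
      congr 1
      ring
    · grind

theorem invol_mem_blockFunctions {φ : Flow ℝ X} {S : Set X} {f : C_c(ℝ, C(X, ℂ))}
    (hf : f ∈ blockFunctions φ S) : invol φ f ∈ blockFunctions φ S := by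
  rintro x s ⟨y, hy, t, rfl, ht⟩
  have h : f (-s) (φ (-s) (φ t y)) = 0 := by
    refine hf _ _ ⟨y, hy, t - s, ?_, ?_⟩
    · rw [← φ.map_add]
      congr 1
      ring
    · grind
  rw [invol_apply, act_apply, ContinuousMap.star_apply, h, star_zero]

/-- The image in `C(X) ⋊ ℝ` of the `*`-algebra `blockFunctions φ S`. -/
noncomputable def blockImage (φ : Flow ℝ X) (S : Set X) :
    NonUnitalStarSubalgebra ℂ (CrossedProduct φ) where
  carrier := toCrossedProduct φ '' blockFunctions φ S
  add_mem' := by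
    rintro _ _ ⟨f, hf, rfl⟩ ⟨g, hg, rfl⟩
    refine ⟨f + g, fun x s h => ?_, Subtype.ext (universalRep_add φ f g)⟩
    rw [CompactlySupportedContinuousMap.add_apply, ContinuousMap.add_apply, hf x s h, hg x s h,
      add_zero]
  zero_mem' := ⟨0, fun _ _ _ => rfl, Subtype.ext (universalRep_zero φ)⟩
  mul_mem' := by
    rintro _ _ ⟨f, hf, rfl⟩ ⟨g, hg, rfl⟩
    exact ⟨conv φ f g, conv_mem_blockFunctions hf hg, Subtype.ext (universalRep_conv φ f g)⟩
  smul_mem' := by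
    rintro c _ ⟨f, hf, rfl⟩
    refine ⟨c • f, fun x s h => ?_, Subtype.ext (universalRep_smul φ c f)⟩
    rw [CompactlySupportedContinuousMap.smul_apply, ContinuousMap.smul_apply, hf x s h, smul_zero]
  star_mem' := by
    rintro _ ⟨f, hf, rfl⟩
    exact ⟨invol φ f, invol_mem_blockFunctions hf, Subtype.ext (universalRep_invol φ f)⟩

/-- The closure of the `*`-algebra `blockFunctions φ S` in `C(X) ⋊ ℝ`. -/
noncomputable def blockAlgebra (φ : Flow ℝ X) (S : Set X) :
    NonUnitalStarSubalgebra ℂ (CrossedProduct φ) :=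
  (blockImage φ S).topologicalClosure

instance isClosed_blockAlgebra (φ : Flow ℝ X) (S : Set X) :
    IsClosed (blockAlgebra φ S : Set (CrossedProduct φ)) :=
  NonUnitalStarSubalgebra.isClosed_topologicalClosure _

/-- An element of `blockFunctions φ S`, viewed in `blockAlgebra φ S`. -/
noncomputable def toBlockAlgebra (φ : Flow ℝ X) (S : Set X) (f : C_c(ℝ, C(X, ℂ)))
    (hf : f ∈ blockFunctions φ S) : blockAlgebra φ S :=
  ⟨toCrossedProduct φ f, NonUnitalStarSubalgebra.le_topologicalClosure _ ⟨f, hf, rfl⟩⟩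

end CrossedProduct

/-! ### Compact operators -/

section Compact

variable {H : Type*} [NormedAddCommGroup H] [InnerProductSpace ℂ H] [CompleteSpace H]

theorem isCompactOperator_star {T : H →L[ℂ] H} (hT : IsCompactOperator T) :
    IsCompactOperator (star T : H →L[ℂ] H) := by
  classical
  have hTT : IsCompactOperator (T * star T : H →L[ℂ] H) := IsCompactOperator.comp_clm hT (star T)
  have hc : IsCompact (closure ((T * star T : H →L[ℂ] H) '' Metric.closedBall 0 1)) :=
    hTT.isCompact_closure_image_closedBall 1
  have htb : TotallyBounded ((T * star T : H →L[ℂ] H) '' Metric.closedBall 0 1) :=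
    hc.totallyBounded.subset subset_closure
  have key : TotallyBounded ((star T : H →L[ℂ] H) '' Metric.closedBall 0 1) := by
    rw [Metric.totallyBounded_iff]
    intro ε hε
    obtain ⟨F, hF, hFfin, hcov⟩ := Metric.finite_approx_of_totallyBounded htb (ε ^ 2 / 4) (by positivity)
    obtain ⟨G, hG, hGfin, rfl⟩ := exists_subset_image_finite_and.1 ⟨F, hF, hFfin, rfl⟩
    refine ⟨(star T : H →L[ℂ] H) '' G, hGfin.image _, ?_⟩
    rintro _ ⟨ξ, hξ, rfl⟩
    obtain ⟨_, ⟨η, hη, rfl⟩, hd⟩ := mem_iUnion₂.1 (hcov ⟨ξ, hξ, rfl⟩)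
    refine mem_iUnion₂.2 ⟨_, ⟨η, hη, rfl⟩, ?_⟩
    have hη1 := hG hη
    rw [Metric.mem_ball, dist_eq_norm, ← map_sub] at hd ⊢
    rw [mem_closedBall_zero_iff] at hξ hη1
    have h1 : ‖(star T : H →L[ℂ] H) (ξ - η)‖ ^ 2 ≤
        ‖(T * star T : H →L[ℂ] H) (ξ - η)‖ * ‖ξ - η‖ := by
      have h2 : inner ℂ ((star T : H →L[ℂ] H) (ξ - η)) ((star T : H →L[ℂ] H) (ξ - η)) =
          inner ℂ (ξ - η) ((T * star T : H →L[ℂ] H) (ξ - η)) := by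
        rw [ContinuousLinearMap.star_eq_adjoint, ContinuousLinearMap.adjoint_inner_left]
        rfl
      have h3 := norm_inner_le_norm (𝕜 := ℂ) (ξ - η) ((T * star T : H →L[ℂ] H) (ξ - η))
      rw [← h2, inner_self_eq_norm_sq_to_K] at h3
      simpa [mul_comm] using h3
    have h4 : ‖ξ - η‖ ≤ 2 := (norm_sub_le _ _).trans (by linarith)
    have h5 : ‖(star T : H →L[ℂ] H) (ξ - η)‖ ^ 2 < ε ^ 2 := by
      nlinarith [norm_nonneg ((T * star T : H →L[ℂ] H) (ξ - η)), norm_nonneg (ξ - η), sq_pos_of_pos hε]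
    exact lt_of_pow_lt_pow_left₀ 2 hε.le h5
  exact (isCompactOperator_iff_isCompact_closure_image_closedBall
    ((star T : H →L[ℂ] H) : H →ₗ[ℂ] H) one_pos).2 (key.closure.isCompact_of_isClosed isClosed_closure)

variable (H) in
/-- The `C^*`-algebra `𝕂(H)` of compact operators on the Hilbert space `H`. -/
def compactOperators : NonUnitalStarSubalgebra ℂ (H →L[ℂ] H) where
  carrier := {T | IsCompactOperator T}
  add_mem' := fun hS hT => IsCompactOperator.add hS hT
  zero_mem' := isCompactOperator_zero
  mul_mem' := fun hS _ => IsCompactOperator.comp_clm hS _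
  smul_mem' := fun c _ hT => IsCompactOperator.smul hT c
  star_mem' := fun hT => isCompactOperator_star hT

instance isClosed_compactOperators : IsClosed (compactOperators H : Set (H →L[ℂ] H)) :=
  isClosed_setOfPred_isCompactOperator

end Compact

/-- The Hilbert space `L²([0,1])`. -/
abbrev L2I : Type := Lp ℂ 2 ((volume : Measure ℝ).restrict (Icc 0 1))

end FlowAlg

open FlowAlg

/-!
The idea is to cut the orbits at the points of the slice `S = S n`. A clopen part of a Cantor slice
inside the interior of its flowbox is a compact cross section (`IsFlowbox.isCrossSection`). By
minimality every orbit returns to it, the return time `τ` is continuous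
(`IsCrossSection.continuous_arriveTime`), and the suspension map `(y, t) ↦ φ_{τ(y) t}(y)` from
`S × [0, 1]` onto `X` is a quotient map which is injective away from the ends
(`exists_suspension_eq`, `suspension_injective`). The defining condition of `blockFunctions φ S` says
that the kernel `(t, s) ↦ τ f(τ (t - s))(φ_{τ t}(y))` of `f` along the orbit of `y` does not connect
different cells, a cell being the time between two consecutive visits of `S`
(`orbitKernel_eq_zero_of_left`, `orbitKernel_eq_zero_of_right`). Hence restricting kernels to the
cell `[0, 1]` is multiplicative on the block, and defines a `*`-homomorphism `symbol` from
`blockFunctions φ S` to `C(S, 𝕂)`. Three facts turn it into the isomorphism.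

* The symbol does not increase the universal norm: its value at `y` is the compression to `[0, 1]` of
  the integrated form of a covariant representation on `L²(ℝ)`, the regular representation along the
  orbit of `y` (`norm_cellOp_le`).
* The universal norm is at most the norm of the symbol. On a cell, the kernel of `f * g * f` is
  pointwise bounded by a constant, depending on `f`, times the operator norm of `g` on this cell, so
  that the `L¹`-norm of `f * g * f` is at most `C_f ‖symbol g‖`
  (`exists_integral_norm_conv_conv_le`). For `h = f* * f` and `g = h ^ (n + 1)` this yields
  `‖ρ(h) ^ (n + 3)‖ ≤ C ‖symbol h‖ ^ (n + 1)` in every covariant representation `ρ`, and comparing the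
  growth of both sides, `‖ρ(h)‖ ≤ ‖symbol h‖` (`norm_integrated_le`).
* The symbols are dense in `C(S, 𝕂)` (`dense_image_symbol`). If `g` is continuous on `S`, and `a`, `b`
  are continuous on `[0, 1]` and vanish at the end points, then the kernel `g(y) a(t) b(s)` on each
  cell, extended by zero across the visits of `S`, comes from a function in the block
  (`exists_mem_blockFunctions_orbitKernel_eq`). Such kernels span the finite rank operators up to
  closure, and `S` is totally disconnected and compact, so locally constant fields suffice.

An isometric `*`-homomorphism with dense range extends to an isometric isomorphism of the closures
(`exists_starAlgEquiv_of_norm_eq`).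
-/

namespace FlowAlg

/-! ### Flowboxes as neighbourhoods of their central slices -/

section Sections

variable {X : Type u} [TopologicalSpace X] {φ : Flow ℝ X}

theorem flow_sub_of_eq {φ : Flow ℝ X} {s t : ℝ} {x y : X} (h : φ s x = φ t y) :
    φ (s - t) x = y := by
  rw [sub_eq_neg_add, φ.map_add, h, ← φ.map_add, neg_add_cancel, φ.map_zero_apply]

/-- The interval between the entrance and the exit time is the largest interval around `0`
during which the orbit stays in the box. -/
theorem IsBoxTime.le_and_le {B : Set X} {l a b c d : ℝ} {x : X} (h : IsBoxTime φ B l x a b)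
    (hc : c ≤ 0) (hd : 0 ≤ d) (hcd : ∀ t ∈ Icc c d, φ t x ∈ B) : a ≤ c ∧ d ≤ b := by
  obtain ⟨ha, hb, -, -, ε, hε, hout⟩ := h
  constructor
  · by_contra! hlt
    have h1 : max c (a - ε / 2) < a := max_lt hlt (by linarith)
    have h2 := le_max_left c (a - ε / 2)
    have h3 := le_max_right c (a - ε / 2)
    exact hout _ (Or.inl ⟨by linarith, h1⟩) (hcd _ ⟨h2, by linarith⟩)
  · by_contra! hlt
    have h1 : b < min d (b + ε / 2) := lt_min hlt (by linarith)
    have h2 := min_le_left d (b + ε / 2)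
    have h3 := min_le_right d (b + ε / 2)
    exact hout _ (Or.inr ⟨h1, by linarith⟩) (hcd _ ⟨by linarith, h2⟩)

theorem IsFlowbox.mem_centralSlice_iff {B : Set X} {l : ℝ} (hB : IsFlowbox φ B l) {x : X} :
    x ∈ centralSlice φ B l ↔ ∀ t ∈ Icc (-(l / 2)) (l / 2), φ t x ∈ B := by
  obtain ⟨-, hl, hbox⟩ := hB
  constructor
  · rintro ⟨-, a, b, ⟨-, -, hab, hin, -⟩, h0⟩ t ht
    exact hin t ⟨by linarith [ht.1], by linarith [ht.2]⟩
  · intro h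
    have hx : x ∈ B := by simpa using h 0 ⟨by linarith, by linarith⟩
    obtain ⟨a, b, hab⟩ := hbox x hx
    have h1 := hab.le_and_le (by linarith) (by linarith) h
    have h2 := hab.2.2.1
    exact ⟨hx, a, b, hab, by linarith⟩

theorem IsFlowbox.exists_mem_centralSlice {B : Set X} {l : ℝ} (hB : IsFlowbox φ B l) {x : X}
    (hx : x ∈ B) : ∃ z ∈ centralSlice φ B l, ∃ t ∈ Icc (-(l / 2)) (l / 2), φ t z = x := by
  obtain ⟨a, b, ha, hb, hl, hin, -⟩ := hB.2.2 x hx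
  refine ⟨φ ((a + b) / 2) x, hB.mem_centralSlice_iff.2 fun t ht => ?_, -((a + b) / 2), ?_, ?_⟩
  · rw [← φ.map_add]
    exact hin _ ⟨by linarith [ht.1], by linarith [ht.2]⟩
  · constructor <;> linarith
  · rw [← φ.map_add, neg_add_cancel, φ.map_zero_apply]

/-- The flow coordinates in a flowbox are unique. -/
theorem IsFlowbox.time_unique {B : Set X} {l : ℝ} (hB : IsFlowbox φ B l) {z z' : X} {t t' : ℝ}
    (hz : z ∈ centralSlice φ B l) (hz' : z' ∈ centralSlice φ B l)
    (ht : t ∈ Icc (-(l / 2)) (l / 2)) (ht' : t' ∈ Icc (-(l / 2)) (l / 2))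
    (h : φ t z = φ t' z') : t = t' := by
  rw [hB.mem_centralSlice_iff] at hz hz'
  obtain ⟨a, b, hab⟩ := hB.2.2 _ (hz t ht)
  have h1 := hab.le_and_le (c := -(l / 2) - t) (d := l / 2 - t) (by linarith [ht.1])
    (by linarith [ht.2]) fun s hs => by
      rw [← φ.map_add]; exact hz _ ⟨by linarith [hs.1], by linarith [hs.2]⟩
  have h2 := hab.le_and_le (c := -(l / 2) - t') (d := l / 2 - t') (by linarith [ht'.1])
    (by linarith [ht'.2]) fun s hs => by
      rw [h, ← φ.map_add]; exact hz' _ ⟨by linarith [hs.1], by linarith [hs.2]⟩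
  linarith [hab.2.2.1]

theorem IsFlowbox.isCompact_centralSlice [T2Space X] {B : Set X} {l : ℝ}
    (hB : IsFlowbox φ B l) : IsCompact (centralSlice φ B l) := by
  have h : centralSlice φ B l = B ∩ ⋂ t ∈ Icc (-(l / 2)) (l / 2), φ t ⁻¹' B := by
    ext x
    rw [hB.mem_centralSlice_iff, mem_inter_iff, mem_iInter₂]
    refine ⟨fun h => ⟨?_, h⟩, fun h => h.2⟩
    simpa using h 0 ⟨by linarith [hB.2.1], by linarith [hB.2.1]⟩
  rw [h]
  exact hB.1.inter_right (isClosed_biInter fun t _ =>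
    hB.1.isClosed.preimage (φ.continuous continuous_const continuous_id))

/-- A compact cross section of a flow: orbits leave it immediately and the points close to it are
reached from it in short time. -/
structure IsCrossSection (φ : Flow ℝ X) (S : Set X) : Prop where
  isCompact : IsCompact S
  nonempty : S.Nonempty
  exists_separated : ∃ δ > 0, ∀ y ∈ S, ∀ t : ℝ, φ t y ∈ S → |t| < δ → t = 0
  mem_nhds : ∀ η > 0, ∀ y ∈ S, {x | ∃ z ∈ S, ∃ t : ℝ, |t| < η ∧ φ t z = x} ∈ nhds y

/-- A non-empty clopen part of the central slice of a flowbox that lies in the interior of the box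
is a cross section. -/
theorem IsFlowbox.isCrossSection [T2Space X] {B S : Set X} {l : ℝ} (hB : IsFlowbox φ B l)
    (hne : S.Nonempty) (hS : S ⊆ centralSlice φ B l ∩ interior B)
    (hclopen : IsClopen ((↑) ⁻¹' S : Set (centralSlice φ B l))) : IsCrossSection φ S := by
  have hl := hB.2.1
  set Z := centralSlice φ B l with hZ
  have hZc : IsCompact Z := hB.isCompact_centralSlice
  have himg : S = (↑) '' ((↑) ⁻¹' S : Set Z) := by
    rw [Subtype.image_preimage_coe, inter_eq_right.2 fun y hy => (hS hy).1]
  have : CompactSpace Z := isCompact_iff_compactSpace.1 hZc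
  refine ⟨?_, hne, ⟨l / 2, by linarith, fun y hy t hty ht => ?_⟩, fun η hη y hy => ?_⟩
  · rw [himg]
    exact hclopen.isClosed.isCompact.image continuous_subtype_val
  · have := (abs_lt.1 ht)
    exact hB.time_unique (z := y) (z' := φ t y) (hS hy).1 (hS hty).1
      ⟨by linarith, by linarith⟩ (t' := 0) ⟨by linarith, by linarith⟩ (by simp)
  · -- the points of the box whose coordinates are not close to those of `S` form a compact set
    let K₁ : Set X := (fun p : ℝ × X => φ p.1 p.2) '' (Icc (-(l / 2)) (l / 2) ×ˢ (Z \ S))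
    let K₂ : Set X := (fun p : ℝ × X => φ p.1 p.2) ''
      ((Icc (-(l / 2)) (l / 2) ∩ {t | η ≤ |t|}) ×ˢ Z)
    have hcont : Continuous fun p : ℝ × X => φ p.1 p.2 :=
      φ.continuous continuous_fst continuous_snd
    have hdiff : IsCompact (Z \ S) := by
      have : Z \ S = (↑) '' ((↑) ⁻¹' S : Set Z)ᶜ := by
        rw [← preimage_compl, Subtype.image_preimage_coe]; rfl
      rw [this]
      exact hclopen.compl.isClosed.isCompact.image continuous_subtype_val
    have hK₁ : IsClosed K₁ := ((isCompact_Icc.prod hdiff).image hcont).isClosed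
    have hK₂ : IsClosed K₂ := (((isCompact_Icc.inter_right
      (isClosed_le continuous_const continuous_abs)).prod hZc).image hcont).isClosed
    have hy₁ : y ∉ K₁ := by
      rintro ⟨⟨t, z⟩, ⟨ht, hz, hzS⟩, h⟩
      have ht0 : t = 0 := hB.time_unique hz (hS hy).1 ht (t' := 0)
        ⟨by linarith, by linarith⟩ (by simpa using h)
      subst ht0
      apply hzS
      have : z = y := by simpa using h
      rwa [this]
    have hy₂ : y ∉ K₂ := by
      rintro ⟨⟨t, z⟩, ⟨⟨ht, hηt⟩, hz⟩, h⟩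
      have ht0 : t = 0 := hB.time_unique hz (hS hy).1 ht (t' := 0)
        ⟨by linarith, by linarith⟩ (by simpa using h)
      subst ht0
      simp only [mem_ofPred_eq, abs_zero] at hηt
      linarith
    filter_upwards [isOpen_interior.mem_nhds (hS hy).2, hK₁.isOpen_compl.mem_nhds hy₁,
      hK₂.isOpen_compl.mem_nhds hy₂] with x hxB hx₁ hx₂
    obtain ⟨z, hz, t, ht, rfl⟩ := hB.exists_mem_centralSlice (interior_subset hxB)
    refine ⟨z, ?_, t, ?_, rfl⟩
    · by_contra hzS
      exact hx₁ ⟨(t, z), ⟨ht, hz, hzS⟩, rfl⟩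
    · by_contra! hηt
      exact hx₂ ⟨(t, z), ⟨⟨ht, hηt⟩, hz⟩, rfl⟩

theorem IsFlowbox.centralSlice_nonempty {B : Set X} {l : ℝ} (hB : IsFlowbox φ B l)
    (hne : B.Nonempty) : (centralSlice φ B l).Nonempty := by
  obtain ⟨x, hx⟩ := hne
  obtain ⟨z, hz, -⟩ := hB.exists_mem_centralSlice hx
  exact ⟨z, hz⟩

/-! ### Return times to a cross section -/

namespace IsCrossSection

variable {S : Set X}

theorem exists_pos_mem (hS : IsCrossSection φ S) (hmin : IsMinimal φ) (x : X) :
    ∃ t > 0, φ t x ∈ S := by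
  obtain ⟨y, hy⟩ := hS.nonempty
  obtain ⟨_, ⟨t, ht, rfl⟩, hmem⟩ :=
    (hmin (φ 1 x)).inter_nhds_nonempty (hS.mem_nhds 1 one_pos y hy)
  obtain ⟨z, hz, r, hr, hrz⟩ := hmem
  refine ⟨t + 1 - r, ?_, ?_⟩
  · have h0 : (0 : ℝ) ≤ t := ht
    linarith [(abs_lt.1 hr).2]
  · have h1 : φ (t + 1) x = φ r z := by rw [hrz, φ.map_add]
    rwa [flow_sub_of_eq h1]

theorem bddBelow (S : Set X) (y : X) : BddBelow {t : ℝ | 0 < t ∧ φ t y ∈ S} :=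
  ⟨0, fun _ ht => ht.1.le⟩

theorem arriveTime_le {y : X} {t : ℝ} (ht : 0 < t) (h : φ t y ∈ S) : arriveTime φ S y ≤ t :=
  csInf_le (bddBelow S y) ⟨ht, h⟩

theorem isLeast_arriveTime [T2Space X] (hS : IsCrossSection φ S) (hmin : IsMinimal φ) {y : X}
    (hy : y ∈ S) : IsLeast {t : ℝ | 0 < t ∧ φ t y ∈ S} (arriveTime φ S y) := by
  obtain ⟨δ, hδ, hsep⟩ := hS.exists_separated
  have hset : {t : ℝ | 0 < t ∧ φ t y ∈ S} = Ici δ ∩ (fun t => φ t y) ⁻¹' S := by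
    ext t
    refine ⟨fun ⟨h0, h⟩ => ⟨?_, h⟩, fun ⟨h0, h⟩ => ⟨hδ.trans_le h0, h⟩⟩
    by_contra! hlt
    exact h0.ne' (hsep y hy t h (abs_lt.2 ⟨by linarith, not_le.1 hlt⟩))
  have hclosed : IsClosed {t : ℝ | 0 < t ∧ φ t y ∈ S} := by
    rw [hset]
    exact isClosed_Ici.inter (hS.isCompact.isClosed.preimage
      (φ.continuous continuous_id continuous_const))
  have hne : {t : ℝ | 0 < t ∧ φ t y ∈ S}.Nonempty := by
    obtain ⟨t, ht, h⟩ := hS.exists_pos_mem hmin y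
    exact ⟨t, ht, h⟩
  exact ⟨hclosed.csInf_mem hne (bddBelow S y), fun t ht => csInf_le (bddBelow S y) ht⟩

variable [T2Space X] (hS : IsCrossSection φ S) (hmin : IsMinimal φ)
include hS hmin

theorem arriveTime_pos {y : X} (hy : y ∈ S) : 0 < arriveTime φ S y :=
  (hS.isLeast_arriveTime hmin hy).1.1

theorem flow_arriveTime_mem {y : X} (hy : y ∈ S) : φ (arriveTime φ S y) y ∈ S :=
  (hS.isLeast_arriveTime hmin hy).1.2

theorem continuous_arriveTime : Continuous fun y : S => arriveTime φ S y := by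
  obtain ⟨δ, hδ, hsep⟩ := hS.exists_separated
  rw [continuous_iff_continuousAt]
  rintro ⟨y, hy⟩
  have hτ := hS.arriveTime_pos hmin hy
  rw [ContinuousAt, Metric.tendsto_nhds]
  intro ε hε
  have hcont : Continuous fun p : ℝ × X => φ p.1 p.2 :=
    φ.continuous continuous_fst continuous_snd
  -- upper semicontinuity: nearby orbits hit the section at nearby times
  have hup : ∀ᶠ z : S in nhds ⟨y, hy⟩, arriveTime φ S z < arriveTime φ S y + ε := by
    have h1 := hS.mem_nhds (min ε (arriveTime φ S y)) (lt_min hε hτ) _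
      (hS.flow_arriveTime_mem hmin hy)
    have h2 : Continuous fun z : S => φ (arriveTime φ S y) z :=
      φ.continuous continuous_const continuous_subtype_val
    filter_upwards [h2.continuousAt (x := ⟨y, hy⟩) h1] with z hz
    obtain ⟨w, hw, t, ht, htw⟩ := hz
    have h3 := abs_lt.1 ht
    have h4 := min_le_left ε (arriveTime φ S y)
    have h5 := min_le_right ε (arriveTime φ S y)
    have h6 : φ (arriveTime φ S y - t) z ∈ S := by rwa [flow_sub_of_eq htw.symm]
    have := arriveTime_le (by linarith) h6
    linarith
  -- lower semicontinuity: before its return, an orbit has positive distance from the section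
  have hlow : ∀ᶠ z : S in nhds ⟨y, hy⟩, arriveTime φ S y - ε < arriveTime φ S z := by
    have h1 : ∀ᶠ z in nhds y, ∀ t ∈ Icc δ (arriveTime φ S y - ε), φ t z ∉ S := by
      refine isCompact_Icc.eventually_forall_of_forall_eventually fun t ht => ?_
      have h2 : φ t y ∉ S := fun h => by
        have := arriveTime_le (hδ.trans_le ht.1) h
        linarith [ht.2]
      have h3 : Continuous fun p : X × ℝ => φ p.2 p.1 :=
        φ.continuous continuous_snd continuous_fst
      exact h3.continuousAt (x := (y, t)) (hS.isCompact.isClosed.isOpen_compl.mem_nhds h2)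
    filter_upwards [continuous_subtype_val.continuousAt (x := (⟨y, hy⟩ : S)) h1] with z hz
    by_contra! hle
    have h4 := hS.isLeast_arriveTime hmin z.2
    refine hz _ ⟨?_, hle⟩ h4.1.2
    by_contra! hlt
    exact h4.1.1.ne' (hsep z z.2 _ h4.1.2 (abs_lt.2 ⟨by linarith [h4.1.1], hlt⟩))
  filter_upwards [hup, hlow] with z hz1 hz2
  rw [Real.dist_eq, abs_lt]
  constructor <;> linarith

theorem exists_arriveTime_le : ∃ T > 0, ∀ y ∈ S, arriveTime φ S y ≤ T := by
  obtain ⟨T, hT⟩ := hS.isCompact.bddAbove_image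
    ((continuousOn_iff_continuous_domRestrict (f := arriveTime φ S)).2 (hS.continuous_arriveTime hmin))
  obtain ⟨y, hy⟩ := hS.nonempty
  exact ⟨T, (hS.arriveTime_pos hmin hy).trans_le (hT ⟨y, hy, rfl⟩), fun z hz => hT ⟨z, hz, rfl⟩⟩

omit hS hmin in
/-- The suspension map `(y, t) ↦ φ_{τ(y) t}(y)`. -/
noncomputable def suspension (φ : Flow ℝ X) (S : Set X) (p : S × ℝ) : X :=
  φ (arriveTime φ S p.1 * p.2) p.1

theorem continuous_suspension : Continuous (suspension φ S) :=
  φ.continuous (((hS.continuous_arriveTime hmin).comp continuous_fst).mul continuous_snd)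
    (continuous_subtype_val.comp continuous_fst)

/-- The orbit segments between consecutive visits of the section cover the space: a point which the
orbit of `y ∈ S` reaches at time `t` lies in the segment started at the last visit before `t`, and
by minimality the orbit of `y` is dense. -/
theorem exists_suspension_eq (x : X) : ∃ y : S, ∃ t ∈ Icc (0 : ℝ) 1, suspension φ S (y, t) = x := by
  have : CompactSpace S := isCompact_iff_compactSpace.1 hS.isCompact
  obtain ⟨δ, hδ, hsep⟩ := hS.exists_separated
  set K : Set X := suspension φ S '' (univ ×ˢ Icc (0 : ℝ) 1) with hK
  have hKc : IsClosed K :=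
    ((isCompact_univ.prod isCompact_Icc).image (hS.continuous_suspension hmin)).isClosed
  have hle : ∀ y ∈ S, δ ≤ arriveTime φ S y := fun y hy => by
    have h4 := hS.isLeast_arriveTime hmin hy
    by_contra! hlt
    exact h4.1.1.ne' (hsep y hy _ h4.1.2 (abs_lt.2 ⟨by linarith [h4.1.1], hlt⟩))
  have key : ∀ n : ℕ, ∀ y ∈ S, ∀ t : ℝ, 0 ≤ t → t ≤ n * δ → φ t y ∈ K := by
    intro n
    induction n with
    | zero =>
      intro y hy t h0 ht
      have : t = 0 := le_antisymm (by simpa using ht) h0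
      subst this
      exact ⟨(⟨y, hy⟩, 0), by simp, by simp [suspension]⟩
    | succ n ih =>
      intro y hy t h0 ht
      have hτ := hS.arriveTime_pos hmin hy
      by_cases hlt : t ≤ arriveTime φ S y
      · refine ⟨(⟨y, hy⟩, t / arriveTime φ S y), ⟨trivial, by positivity, ?_⟩, ?_⟩
        · rwa [div_le_one hτ]
        · simp only [suspension]
          rw [mul_div_cancel₀ _ hτ.ne']
      · have h1 := ih _ (hS.flow_arriveTime_mem hmin hy) (t - arriveTime φ S y)
          (by linarith) (by push_cast at ht; linarith [hle y hy])
        rwa [← φ.map_add, sub_add_cancel] at h1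
  obtain ⟨y, hy⟩ := hS.nonempty
  have hsub : (fun t : ℝ => φ t y) '' Ici 0 ⊆ K := by
    rintro _ ⟨t, ht, rfl⟩
    obtain ⟨n, hn⟩ := exists_nat_ge (t / δ)
    exact key n y hy t ht ((div_le_iff₀ hδ).1 hn)
  have hx : x ∈ K := closure_minimal hsub hKc (hmin y x)
  obtain ⟨⟨z, t⟩, ⟨-, ht⟩, rfl⟩ := hx
  exact ⟨z, t, ht, rfl⟩

/-- Between its visits of the section, an orbit has unique suspension coordinates. -/
theorem suspension_injective {y z : S} {t s : ℝ} (ht : t ∈ Ioo (0 : ℝ) 1) (hs : s ∈ Icc (0 : ℝ) 1)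
    (h : suspension φ S (y, t) = suspension φ S (z, s)) : y = z ∧ t = s := by
  have hy := hS.isLeast_arriveTime hmin y.2
  have hz := hS.isLeast_arriveTime hmin z.2
  set a := arriveTime φ S y
  set b := arriveTime φ S z
  have h' : φ (a * t) (y : X) = φ (b * s) z := h
  have ha : 0 < a := hy.1.1
  have hb : 0 < b := hz.1.1
  have h1 := flow_sub_of_eq h'
  have h2 := flow_sub_of_eq h'.symm
  have hat : a * t < a := by nlinarith [ht.2]
  have hat0 : 0 < a * t := mul_pos ha ht.1
  have hbs : b * s ≤ b := by nlinarith [hs.2]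
  have hbs0 : 0 ≤ b * s := mul_nonneg hb.le hs.1
  rcases lt_trichotomy (a * t) (b * s) with hlt | heq | hgt
  · have := hz.2 ⟨sub_pos.2 hlt, by rw [h2]; exact y.2⟩
    linarith
  · have hyz : y = z := by
      apply Subtype.ext
      rw [heq, sub_self, φ.map_zero_apply] at h1
      exact h1
    subst hyz
    exact ⟨rfl, mul_left_cancel₀ ha.ne' heq⟩
  · have := hy.2 ⟨sub_pos.2 hgt, by rw [h1]; exact z.2⟩
    linarith

end IsCrossSection

end Sections

/-! ### Integral operators on `L²([0,1])` -/

/-- Lebesgue measure on `[0,1]`, as a measure on `ℝ`. -/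
noncomputable abbrev unitMeasure : Measure ℝ := volume.restrict (Icc 0 1)

instance : IsProbabilityMeasure unitMeasure := ⟨by simp [unitMeasure]⟩

theorem integral_norm_le_norm_L2 (ξ : L2I) : ∫ s, ‖ξ s‖ ∂unitMeasure ≤ ‖ξ‖ := by
  rw [integral_norm_eq_lintegral_enorm (Lp.aestronglyMeasurable ξ),
    ← eLpNorm_one_eq_lintegral_enorm, Lp.norm_def]
  exact ENNReal.toReal_mono (Lp.eLpNorm_ne_top ξ)
    (eLpNorm_le_eLpNorm_of_exponent_le (by norm_num) (Lp.aestronglyMeasurable ξ))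

theorem integrable_L2 (ξ : L2I) : Integrable ξ unitMeasure :=
  (Lp.memLp ξ).integrable (by norm_num)

theorem ae_unitMeasure {p : ℝ → Prop} (h : ∀ t ∈ Icc (0 : ℝ) 1, p t) : ∀ᵐ t ∂unitMeasure, p t :=
  (ae_restrict_mem measurableSet_Icc).mono h

theorem memLp_of_bound_unit {a : ℝ → ℂ} (ha : Measurable a) {C : ℝ}
    (hC : ∀ t ∈ Icc (0 : ℝ) 1, ‖a t‖ ≤ C) : MemLp a 2 unitMeasure :=
  MemLp.of_bound ha.aestronglyMeasurable C (ae_unitMeasure hC)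

theorem norm_L2_le_of_bound {ξ : L2I} {C : ℝ} (h0 : 0 ≤ C)
    (hC : ∀ᵐ t ∂unitMeasure, ‖ξ t‖ ≤ C) : ‖ξ‖ ≤ C := by
  have h1 : measureUnivNNReal unitMeasure = 1 := by simp [measureUnivNNReal]
  have h := Lp.norm_le_of_ae_bound h0 hC
  rwa [h1, NNReal.coe_one, Real.one_rpow, one_mul] at h

theorem integrable_mul_L2 {a : ℝ → ℂ} (ha : Measurable a) {C : ℝ}
    (hC : ∀ t ∈ Icc (0 : ℝ) 1, ‖a t‖ ≤ C) (ξ : L2I) :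
    Integrable (fun s => a s * ξ s) unitMeasure :=
  (integrable_L2 ξ).bdd_mul ha.aestronglyMeasurable (ae_unitMeasure hC)

theorem norm_integral_mul_L2_le {a : ℝ → ℂ} {C : ℝ}
    (hC : ∀ t ∈ Icc (0 : ℝ) 1, ‖a t‖ ≤ C) (ξ : L2I) :
    ‖∫ s in Icc (0 : ℝ) 1, a s * ξ s‖ ≤ C * ‖ξ‖ := by
  have h0 : 0 ≤ C := (norm_nonneg _).trans (hC 0 ⟨le_rfl, zero_le_one⟩)
  calc ‖∫ s in Icc (0 : ℝ) 1, a s * ξ s‖ ≤ ∫ s in Icc (0 : ℝ) 1, C * ‖ξ s‖ := by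
        refine norm_integral_le_of_norm_le ((integrable_L2 ξ).norm.const_mul C) ?_
        refine ae_unitMeasure fun s hs => ?_
        rw [norm_mul]
        exact mul_le_mul_of_nonneg_right (hC s hs) (norm_nonneg _)
    _ = C * ∫ s in Icc (0 : ℝ) 1, ‖ξ s‖ := integral_const_mul _ _
    _ ≤ C * ‖ξ‖ := mul_le_mul_of_nonneg_left (integral_norm_le_norm_L2 ξ) h0

/-- The operator `T` on `L²([0,1])` is the integral operator with kernel `k`. -/
def IsIntegralOp (k : ℝ → ℝ → ℂ) (T : L2I →L[ℂ] L2I) : Prop :=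
  ∀ ξ : L2I, ∀ᵐ t ∂unitMeasure, T ξ t = ∫ s in Icc (0 : ℝ) 1, k t s * ξ s

namespace IsIntegralOp

variable {k k' : ℝ → ℝ → ℂ} {T T' : L2I →L[ℂ] L2I}

theorem norm_le (h : IsIntegralOp k T) {C : ℝ}
    (hC : ∀ t ∈ Icc (0 : ℝ) 1, ∀ s ∈ Icc (0 : ℝ) 1, ‖k t s‖ ≤ C) : ‖T‖ ≤ C := by
  have h0 : 0 ≤ C := (norm_nonneg _).trans
    (hC 0 ⟨le_rfl, zero_le_one⟩ 0 ⟨le_rfl, zero_le_one⟩)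
  refine T.opNorm_le_bound h0 fun ξ => ?_
  refine norm_L2_le_of_bound (by positivity) ?_
  filter_upwards [h ξ, ae_restrict_mem measurableSet_Icc] with t ht htI
  rw [ht]
  exact norm_integral_mul_L2_le (hC t htI) ξ

theorem congr (h : IsIntegralOp k T)
    (hk : ∀ t ∈ Icc (0 : ℝ) 1, ∀ s ∈ Icc (0 : ℝ) 1, k t s = k' t s) : IsIntegralOp k' T := by
  intro ξ
  filter_upwards [h ξ, ae_restrict_mem measurableSet_Icc] with t ht htI
  rw [ht]
  exact setIntegral_congr_fun measurableSet_Icc fun s hs => by simp only [hk t htI s hs]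

theorem sub (h : IsIntegralOp k T) (h' : IsIntegralOp k' T') (hk : ∀ t, Measurable (k t))
    (hk' : ∀ t, Measurable (k' t)) {C C' : ℝ}
    (hC : ∀ t ∈ Icc (0 : ℝ) 1, ∀ s ∈ Icc (0 : ℝ) 1, ‖k t s‖ ≤ C)
    (hC' : ∀ t ∈ Icc (0 : ℝ) 1, ∀ s ∈ Icc (0 : ℝ) 1, ‖k' t s‖ ≤ C') :
    IsIntegralOp (fun t s => k t s - k' t s) (T - T') := by
  intro ξ
  filter_upwards [h ξ, h' ξ, ae_restrict_mem measurableSet_Icc, Lp.coeFn_sub (T ξ) (T' ξ)]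
    with t ht ht' htI hsub
  rw [sub_apply, hsub, Pi.sub_apply, ht, ht', ← integral_sub
    (integrable_mul_L2 (hk t) (hC t htI) ξ) (integrable_mul_L2 (hk' t) (hC' t htI) ξ)]
  simp only [sub_mul]

/-- Two integral operators whose kernels are uniformly close are close in norm. -/
theorem norm_sub_le (h : IsIntegralOp k T) (h' : IsIntegralOp k' T') (hk : ∀ t, Measurable (k t))
    (hk' : ∀ t, Measurable (k' t)) {C ε : ℝ}
    (hC : ∀ t ∈ Icc (0 : ℝ) 1, ∀ s ∈ Icc (0 : ℝ) 1, ‖k t s‖ ≤ C)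
    (hε : ∀ t ∈ Icc (0 : ℝ) 1, ∀ s ∈ Icc (0 : ℝ) 1, ‖k t s - k' t s‖ ≤ ε) : ‖T - T'‖ ≤ ε := by
  refine (h.sub h' hk hk' hC (C' := C + ε) fun t ht s hs => ?_).norm_le hε
  calc ‖k' t s‖ = ‖k t s - (k t s - k' t s)‖ := by rw [sub_sub_cancel]
    _ ≤ C + ε := (_root_.norm_sub_le _ _).trans (add_le_add (hC t ht s hs) (hε t ht s hs))

theorem sum {ι : Type*} (F : Finset ι) {k : ι → ℝ → ℝ → ℂ} {T : ι → L2I →L[ℂ] L2I}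
    (h : ∀ i ∈ F, IsIntegralOp (k i) (T i)) (hk : ∀ i t, Measurable (k i t)) {C : ι → ℝ}
    (hC : ∀ i, ∀ t ∈ Icc (0 : ℝ) 1, ∀ s ∈ Icc (0 : ℝ) 1, ‖k i t s‖ ≤ C i) :
    IsIntegralOp (fun t s => ∑ i ∈ F, k i t s) (∑ i ∈ F, T i) := by
  intro ξ
  have h1 : ∀ᵐ t ∂unitMeasure, ∀ i ∈ F, T i ξ t = ∫ s in Icc (0 : ℝ) 1, k i t s * ξ s :=
    (Filter.eventually_all_finset F).2 fun i hi => h i hi ξ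
  filter_upwards [h1, ae_restrict_mem measurableSet_Icc,
    Lp.coeFn_finsetSum F (fun i => T i ξ)] with t ht htI hsum
  rw [sum_apply, hsum, Finset.sum_apply, Finset.sum_congr rfl ht]
  simp only [Finset.sum_mul]
  exact (integral_finsetSum F fun i _ => integrable_mul_L2 (hk i t) (hC i t htI) ξ).symm

theorem smul (h : IsIntegralOp k T) (c : ℂ) : IsIntegralOp (fun t s => c * k t s) (c • T) := by
  intro ξ
  filter_upwards [h ξ, Lp.coeFn_smul c (T ξ)] with t h1 h2
  rw [_root_.smul_apply, h2, Pi.smul_apply, h1, smul_eq_mul, ← integral_const_mul]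
  simp only [mul_assoc]

/-- The operator `ξ ↦ ⟨b̄, ξ⟩ a` of rank one has the kernel `a(t) b(s)`. -/
theorem rankOne {a b : ℝ → ℂ} (ha : MemLp a 2 unitMeasure) (hb : MemLp (star b) 2 unitMeasure) :
    IsIntegralOp (fun t s => a t * b s)
      (InnerProductSpace.rankOne ℂ (ha.toLp a : L2I) (hb.toLp (star b) : L2I)) := by
  intro ξ
  have h1 : inner ℂ (hb.toLp (star b) : L2I) ξ = ∫ s in Icc (0 : ℝ) 1, b s * ξ s := by
    rw [L2.inner_def]
    refine integral_congr_ae ?_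
    filter_upwards [hb.coeFn_toLp] with s hs
    rw [hs]
    simp [mul_comm]
  rw [InnerProductSpace.rankOne_apply, h1]
  filter_upwards [Lp.coeFn_smul (∫ s in Icc (0 : ℝ) 1, b s * ξ s) (ha.toLp a), ha.coeFn_toLp]
    with t ht hat
  rw [ht, Pi.smul_apply, hat, smul_eq_mul, mul_comm, ← integral_const_mul]
  simp only [mul_assoc]

end IsIntegralOp

theorem isCompactOperator_rankOne {H : Type*} [NormedAddCommGroup H] [InnerProductSpace ℂ H]
    (v w : H) : IsCompactOperator (InnerProductSpace.rankOne ℂ v w : H →L[ℂ] H) := by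
  rw [InnerProductSpace.rankOne_def']
  exact (isCompactOperator_of_locallyCompactSpace_dom
    (innerSL ℂ w)).clm_comp (ContinuousLinearMap.toSpanSingleton ℂ v)

namespace IsIntegralOp

variable {k : ℝ → ℝ → ℂ} {T : L2I →L[ℂ] L2I}

/-- Integral operators with continuous kernels are compact: replacing `k(t,s)` by
`k(t,⌊Ns⌋/N)` approximates `T` by operators of finite rank. -/
theorem isCompactOperator (h : IsIntegralOp k T) (hk : Continuous fun p : ℝ × ℝ => k p.1 p.2) :
    IsCompactOperator T := by
  have hK : IsCompact (Icc (0 : ℝ) 1 ×ˢ Icc (0 : ℝ) 1) := isCompact_Icc.prod isCompact_Icc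
  obtain ⟨C, hC⟩ := hK.exists_bound_of_continuousOn hk.continuousOn
  have huc := hK.uniformContinuousOn_of_continuous hk.continuousOn
  have hkt : ∀ t, Continuous (k t) := fun t => hk.comp (Continuous.prodMk_right t)
  have hks : ∀ s, Continuous fun t => k t s := fun s => hk.comp (Continuous.prodMk_left s)
  have hmem : T ∈ closure {T : L2I →L[ℂ] L2I | IsCompactOperator T} := by
    rw [Metric.mem_closure_iff]
    intro ε hε
    obtain ⟨δ, hδ, hd⟩ := Metric.uniformContinuousOn_iff.1 huc (ε / 2) (by positivity)
    obtain ⟨N, hN⟩ := exists_nat_one_div_lt hδ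
    set M : ℝ := N + 1 with hM
    have hM0 : 0 < M := by positivity
    let b : ℕ → ℝ → ℂ := fun i s => if ⌊M * s⌋₊ = i then 1 else 0
    have hbm : ∀ i, Measurable (b i) := fun i =>
      Measurable.ite (measurableSet_eq_fun
        (Nat.measurable_floor.comp (measurable_const.mul measurable_id)) measurable_const)
        measurable_const measurable_const
    have hb1 : ∀ i s, ‖b i s‖ ≤ 1 := fun i s => by
      by_cases hi : ⌊M * s⌋₊ = i <;> simp [b, hi]
    have hbL : ∀ i, MemLp (star (b i)) 2 unitMeasure := fun i =>
      memLp_of_bound_unit (C := 1) (continuous_star.measurable.comp (hbm i))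
        fun s _ => by simpa using hb1 i s
    -- the bound is taken on `[0,1]`, which contains `i / M` only for `i ≤ N + 1`
    have hpt : ∀ i ∈ Finset.range (N + 2), (i : ℝ) / M ∈ Icc (0 : ℝ) 1 := fun i hi => by
      refine ⟨by positivity, (div_le_one hM0).2 ?_⟩
      have : i ≤ N + 1 := Nat.lt_succ_iff.1 (Finset.mem_range.1 hi)
      rw [hM]
      exact_mod_cast this
    have hx : ∀ i, ∃ x ∈ Icc (0 : ℝ) 1, i ∈ Finset.range (N + 2) → x = (i : ℝ) / M := fun i => by
      by_cases hi : i ∈ Finset.range (N + 2)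
      · exact ⟨_, hpt i hi, fun _ => rfl⟩
      · exact ⟨0, by simp, fun h => absurd h hi⟩
    choose x hxI hxe using hx
    have haL : ∀ i, MemLp (fun t => k t (x i)) 2 unitMeasure := fun i =>
      memLp_of_bound_unit (hks _).measurable fun t ht => hC (t, x i) ⟨ht, hxI i⟩
    let T' : L2I →L[ℂ] L2I := ∑ i ∈ Finset.range (N + 2),
      InnerProductSpace.rankOne ℂ ((haL i).toLp _ : L2I) ((hbL i).toLp (star (b i)) : L2I)
    have hmeas : ∀ i t, Measurable fun s => k t (x i) * b i s := fun i t =>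
      (hbm i).const_mul _
    have hT' : IsIntegralOp (fun t s => ∑ i ∈ Finset.range (N + 2), k t (x i) * b i s) T' := by
      refine IsIntegralOp.sum (k := fun i t s => k t (x i) * b i s) (C := fun _ => C) _
        (fun i _ => IsIntegralOp.rankOne (haL i) (hbL i)) hmeas fun i t ht s hs => ?_
      rw [norm_mul]
      exact (mul_le_of_le_one_right (norm_nonneg _) (hb1 i s)).trans (hC (t, x i) ⟨ht, hxI i⟩)
    refine ⟨T', ?_, ?_⟩
    · refine Finset.sum_induction _ (fun T : L2I →L[ℂ] L2I => IsCompactOperator T)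
        (fun _ _ h h' => IsCompactOperator.add h h') isCompactOperator_zero fun i _ => ?_
      exact isCompactOperator_rankOne _ _
    · rw [dist_eq_norm]
      refine (h.norm_sub_le hT' (fun t => (hkt t).measurable)
        (fun t => Finset.measurable_fun_sum _ fun i _ => hmeas i t)
        (fun t ht s hs => hC (t, s) ⟨ht, hs⟩) (ε := ε / 2) fun t ht s hs => ?_).trans_lt
        (half_lt_self hε)
      have hfl : ⌊M * s⌋₊ ∈ Finset.range (N + 2) := by
        rw [Finset.mem_range, Nat.lt_succ_iff]
        refine Nat.floor_le_of_le ?_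
        push_cast
        rw [← hM]
        nlinarith [hs.2]
      have hsum : ∑ i ∈ Finset.range (N + 2), k t (x i) * b i s = k t (⌊M * s⌋₊ / M) := by
        rw [Finset.sum_eq_single_of_mem _ hfl fun i _ hi => by simp [b, hi.symm], hxe _ hfl]
        simp [b]
      rw [hsum, ← dist_eq_norm]
      refine (hd (t, s) ⟨ht, hs⟩ (t, (⌊M * s⌋₊ : ℝ) / M) ⟨ht, hpt _ hfl⟩ ?_).le
      rw [Prod.dist_eq, max_lt_iff]
      refine ⟨by simpa using hδ, ?_⟩
      have h1 := Nat.floor_le (mul_nonneg hM0.le hs.1)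
      have h2 := Nat.lt_floor_add_one (M * s)
      have h3 : s - (⌊M * s⌋₊ : ℝ) / M = (M * s - ⌊M * s⌋₊) / M := by field_simp
      rw [Real.dist_eq, h3, abs_of_nonneg (div_nonneg (by linarith) hM0.le)]
      refine lt_trans ?_ hN
      exact (div_lt_div_iff_of_pos_right hM0).2 (by linarith)
  rwa [IsClosed.closure_eq isClosed_setOfPred_isCompactOperator] at hmem

/-- A twofold iterated kernel is a matrix coefficient of the integral operator in the middle. -/
theorem norm_integral_integral_le (h : IsIntegralOp k T) {a b : ℝ → ℂ}
    (hb : Measurable b) {A B : ℝ} (hA : ∀ t ∈ Icc (0 : ℝ) 1, ‖a t‖ ≤ A)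
    (hB : ∀ t ∈ Icc (0 : ℝ) 1, ‖b t‖ ≤ B) :
    ‖∫ u in Icc (0 : ℝ) 1, a u * ∫ v in Icc (0 : ℝ) 1, k u v * b v‖ ≤ A * ‖T‖ * B := by
  have hbL := memLp_of_bound_unit hb hB
  have hB0 : 0 ≤ B := (norm_nonneg _).trans (hB 0 ⟨le_rfl, zero_le_one⟩)
  have hA0 : 0 ≤ A := (norm_nonneg _).trans (hA 0 ⟨le_rfl, zero_le_one⟩)
  have h1 : ∫ u in Icc (0 : ℝ) 1, a u * ∫ v in Icc (0 : ℝ) 1, k u v * b v =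
      ∫ u in Icc (0 : ℝ) 1, a u * T (hbL.toLp b) u := by
    refine integral_congr_ae ?_
    filter_upwards [h (hbL.toLp b)] with u hu
    rw [hu]
    congr 1
    refine integral_congr_ae ?_
    filter_upwards [hbL.coeFn_toLp] with v hv
    rw [hv]
  rw [h1, mul_assoc]
  refine (norm_integral_mul_L2_le hA _).trans (mul_le_mul_of_nonneg_left ?_ hA0)
  refine (T.le_opNorm _).trans (mul_le_mul_of_nonneg_left ?_ (norm_nonneg _))
  refine norm_L2_le_of_bound hB0 ?_
  filter_upwards [hbL.coeFn_toLp, ae_restrict_mem measurableSet_Icc] with v hv hvI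
  rw [hv]
  exact hB v hvI

end IsIntegralOp

/-! ### The regular representation along an orbit -/

/-- The Hilbert space `L²(ℝ)`. -/
abbrev L2R : Type := Lp ℂ 2 (volume : Measure ℝ)

/-- Multiplication by a bounded continuous function on `L²(ℝ)`. -/
noncomputable def mulL2 (g : BoundedContinuousFunction ℝ ℂ) : L2R →L[ℂ] L2R :=
  (ContinuousLinearMap.mul ℂ ℂ).holderL volume ∞ 2 2
    ((memLp_top_of_bound g.continuous.aestronglyMeasurable ‖g‖
      (Filter.Eventually.of_forall g.norm_coe_le_norm)).toLp g)

theorem coeFn_mulL2 (g : BoundedContinuousFunction ℝ ℂ) (ξ : L2R) :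
    mulL2 g ξ =ᵐ[volume] fun t => g t * ξ t := by
  have hg : MemLp g ∞ (volume : Measure ℝ) :=
    memLp_top_of_bound g.continuous.aestronglyMeasurable ‖g‖
      (Filter.Eventually.of_forall g.norm_coe_le_norm)
  filter_upwards [(ContinuousLinearMap.mul ℂ ℂ).coeFn_holder (r := 2) (hg.toLp g) ξ,
    hg.coeFn_toLp] with t h1 h2
  refine h1.trans ?_
  rw [h2]
  rfl

/-- Translation by `a` on `L²(ℝ)`: `(U_a ξ)(t) = ξ(t - a)`. -/
noncomputable def translationLI (a : ℝ) : L2R →ₗᵢ[ℂ] L2R :=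
  Lp.compMeasurePreservingₗᵢ ℂ (fun t => t - a) (measurePreserving_sub_right volume a)

theorem coeFn_translationLI (a : ℝ) (ξ : L2R) :
    translationLI a ξ =ᵐ[volume] fun t => ξ (t - a) :=
  Lp.coeFn_compMeasurePreserving ξ (measurePreserving_sub_right volume a)

theorem ae_comp_sub {p : ℝ → Prop} (a : ℝ) (h : ∀ᵐ t : ℝ, p t) : ∀ᵐ t : ℝ, p (t - a) :=
  (measurePreserving_sub_right volume a).quasiMeasurePreserving.ae h

theorem translationLI_add (a b : ℝ) (ξ : L2R) :
    translationLI (a + b) ξ = translationLI a (translationLI b ξ) := by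
  refine Lp.ext ?_
  filter_upwards [coeFn_translationLI (a + b) ξ, coeFn_translationLI a (translationLI b ξ),
    ae_comp_sub a (coeFn_translationLI b ξ)] with t h1 h2 h3
  rw [h1, h2, h3, sub_sub]

theorem translationLI_zero (ξ : L2R) : translationLI 0 ξ = ξ := by
  refine Lp.ext ?_
  filter_upwards [coeFn_translationLI 0 ξ] with t h1
  rw [h1, sub_zero]

/-- Translation by `a`, as a unitary operator on `L²(ℝ)`. -/
noncomputable def translation (a : ℝ) : L2R ≃ₗᵢ[ℂ] L2R :=
  LinearIsometryEquiv.ofSurjective (translationLI a) fun ξ =>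
    ⟨translationLI (-a) ξ, by rw [← translationLI_add, add_neg_cancel, translationLI_zero]⟩

theorem translation_apply (a : ℝ) (ξ : L2R) : translation a ξ = translationLI a ξ := rfl

theorem continuous_translation (ξ : L2R) : Continuous fun a => translation a ξ := by
  let g : ℝ → C(ℝ, ℝ) := fun a => ⟨fun t => t - a, by fun_prop⟩
  have hg : Continuous g := ContinuousMap.continuous_of_continuous_uncurry _
    (by simp only [g, Function.uncurry_def, ContinuousMap.coe_mk]; fun_prop)
  exact (continuous_const (y := ξ)).compMeasurePreservingLp hg
    (fun a => measurePreserving_sub_right volume a) (by norm_num)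

/-- The Hilbert space `L²(ℝ)`, moved to an arbitrary universe. -/
abbrev L2RLift : Type u := PiLp 2 fun _ : PUnit.{u + 1} => L2R

/-- The unitary from `L²(ℝ)` to its copy in another universe. -/
noncomputable def liftL2 : L2R ≃ₗᵢ[ℂ] L2RLift.{u} :=
  ⟨(PiLp.equivOfUnique 2 ℂ fun _ : PUnit.{u + 1} => L2R).symm.toLinearEquiv, fun ξ => by
    rw [PiLp.norm_eq_of_L2]
    simp⟩

section Regular

variable {X : Type u} [TopologicalSpace X] [CompactSpace X] [T2Space X]

/-- The restriction of a continuous function to the orbit of `y`, run through at speed `c`. -/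
noncomputable def orbitFunction (φ : Flow ℝ X) (y : X) (c : ℝ) (h : C(X, ℂ)) :
    BoundedContinuousFunction ℝ ℂ :=
  (BoundedContinuousFunction.mkOfCompact h).compContinuous
    ⟨fun t => φ (c * t) y, φ.continuous (continuous_const.mul continuous_id) continuous_const⟩

@[simp]
theorem orbitFunction_apply (φ : Flow ℝ X) (y : X) (c : ℝ) (h : C(X, ℂ)) (t : ℝ) :
    orbitFunction φ y c h t = h (φ (c * t) y) := rfl

/-- The representation of `C(X)` on `L²(ℝ)` by multiplication along the orbit of `y`. -/
noncomputable def orbitRep (φ : Flow ℝ X) (y : X) (c : ℝ) : C(X, ℂ) →⋆ₐ[ℂ] (L2R →L[ℂ] L2R) where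
  toFun h := mulL2 (orbitFunction φ y c h)
  map_one' := by
    ext1 ξ
    refine Lp.ext ?_
    filter_upwards [coeFn_mulL2 (orbitFunction φ y c 1) ξ] with t h1
    rw [h1]
    simp
  map_mul' h k := by
    ext1 ξ
    refine Lp.ext ?_
    filter_upwards [coeFn_mulL2 (orbitFunction φ y c (h * k)) ξ,
      coeFn_mulL2 (orbitFunction φ y c h) (mulL2 (orbitFunction φ y c k) ξ),
      coeFn_mulL2 (orbitFunction φ y c k) ξ] with t h1 h2 h3
    rw [mul_apply_eq_comp, h1, h2, h3]
    simp [mul_assoc]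
  map_zero' := by
    ext1 ξ
    refine Lp.ext ?_
    filter_upwards [coeFn_mulL2 (orbitFunction φ y c 0) ξ, Lp.coeFn_zero ℂ 2 volume] with t h1 h2
    rw [h1, _root_.zero_apply, h2]
    simp
  map_add' h k := by
    ext1 ξ
    refine Lp.ext ?_
    filter_upwards [coeFn_mulL2 (orbitFunction φ y c (h + k)) ξ,
      coeFn_mulL2 (orbitFunction φ y c h) ξ, coeFn_mulL2 (orbitFunction φ y c k) ξ,
      Lp.coeFn_add (mulL2 (orbitFunction φ y c h) ξ) (mulL2 (orbitFunction φ y c k) ξ)]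
      with t h1 h2 h3 h4
    rw [_root_.add_apply, h1, h4, Pi.add_apply, h2, h3]
    simp [add_mul]
  commutes' r := by
    ext1 ξ
    refine Lp.ext ?_
    filter_upwards [coeFn_mulL2 (orbitFunction φ y c (algebraMap ℂ C(X, ℂ) r)) ξ,
      Lp.coeFn_smul r ξ] with t h1 h2
    rw [h1, Algebra.algebraMap_eq_smul_one, Algebra.algebraMap_eq_smul_one, _root_.smul_apply,
      one_apply_eq_self, h2]
    simp
  map_star' h := by
    rw [ContinuousLinearMap.star_eq_adjoint, ContinuousLinearMap.eq_adjoint_iff]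
    intro ξ η
    rw [L2.inner_def, L2.inner_def]
    refine integral_congr_ae ?_
    filter_upwards [coeFn_mulL2 (orbitFunction φ y c (star h)) ξ,
      coeFn_mulL2 (orbitFunction φ y c h) η] with t h1 h2
    rw [h1, h2]
    simp [mul_comm, mul_assoc]

theorem coeFn_orbitRep (φ : Flow ℝ X) (y : X) (c : ℝ) (h : C(X, ℂ)) (ξ : L2R) :
    orbitRep φ y c h ξ =ᵐ[volume] fun t => h (φ (c * t) y) * ξ t :=
  coeFn_mulL2 _ _

/-- The regular representation of the flow along the orbit of `y`, on `L²(ℝ)`: functions act by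
multiplication along the orbit, run through at speed `c`, and the group acts by translation. -/
noncomputable def regularRep (φ : Flow ℝ X) (y : X) {c : ℝ} (hc : 0 < c) : CovariantRep φ where
  H := L2RLift.{u}
  π := (liftL2.{u}.conjStarAlgEquiv : (L2R →L[ℂ] L2R) →⋆ₐ[ℂ] (L2RLift.{u} →L[ℂ] L2RLift.{u})).comp
    (orbitRep φ y c)
  U s := liftL2.{u}.symm.trans ((translation (s / c)).trans liftL2.{u})
  U_add s t ξ := by
    simp [translation_apply, add_div, translationLI_add]
  continuous_U ξ := liftL2.{u}.continuous.comp
    ((continuous_translation (liftL2.{u}.symm ξ)).comp (continuous_id.div_const c))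
  covariant s h ξ := by
    have key : ∀ η : L2R, translation (s / c) (orbitRep φ y c h η) =
        orbitRep φ y c (act φ s h) (translation (s / c) η) := fun η => by
      refine Lp.ext ?_
      filter_upwards [coeFn_translationLI (s / c) (orbitRep φ y c h η),
        ae_comp_sub (s / c) (coeFn_orbitRep φ y c h η),
        coeFn_orbitRep φ y c (act φ s h) (translation (s / c) η),
        coeFn_translationLI (s / c) η] with t h1 h2 h3 h4
      rw [translation_apply, h1, h2, h3, translation_apply, h4, act_apply, ← φ.map_add]
      congr 3
      field_simp
      ring
    simp [key]

/-- The unitary from `L²(ℝ)` to the space of the regular representation. -/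
noncomputable def regularIso (φ : Flow ℝ X) (y : X) {c : ℝ} (hc : 0 < c) :
    L2R ≃ₗᵢ[ℂ] (regularRep φ y hc).H :=
  liftL2.{u}

theorem regularRep_integrand (φ : Flow ℝ X) (y : X) {c : ℝ} (hc : 0 < c) (s : ℝ) (h : C(X, ℂ))
    (ξ : L2R) :
    (regularRep φ y hc).π h ((regularRep φ y hc).U s (regularIso φ y hc ξ)) =
      regularIso φ y hc (orbitRep φ y c h (translation (s / c) ξ)) := by
  change liftL2.{u} (orbitRep φ y c h (liftL2.{u}.symm
    (liftL2.{u} (translation (s / c) (liftL2.{u}.symm (liftL2.{u} ξ)))))) =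
    liftL2.{u} (orbitRep φ y c h (translation (s / c) ξ))
  simp

/-- The integrated form of the regular representation, as an operator on `L²(ℝ)`. -/
noncomputable def regularOp (φ : Flow ℝ X) (y : X) {c : ℝ} (hc : 0 < c) (f : C_c(ℝ, C(X, ℂ))) :
    L2R →L[ℂ] L2R :=
  (regularIso φ y hc).conjStarAlgEquiv.symm ((regularRep φ y hc).integrated f)

theorem norm_regularOp_le (φ : Flow ℝ X) (y : X) {c : ℝ} (hc : 0 < c) (f : C_c(ℝ, C(X, ℂ))) :
    ‖regularOp φ y hc f‖ ≤ ‖(regularRep φ y hc).integrated f‖ :=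
  NonUnitalStarAlgHom.norm_apply_le (regularIso φ y hc).conjStarAlgEquiv.symm _

/-- The kernel of the regular representation of `f` along the orbit of `y`, run through at
speed `c`. -/
noncomputable def orbitKernel (φ : Flow ℝ X) (f : C_c(ℝ, C(X, ℂ))) (y : X) (c t s : ℝ) : ℂ :=
  c * f (c * (t - s)) (φ (c * t) y)

theorem continuous_orbitKernel (φ : Flow ℝ X) (f : C_c(ℝ, C(X, ℂ))) {Y : Type*}
    [TopologicalSpace Y] {y : Y → X} {c t s : Y → ℝ} (hy : Continuous y) (hc : Continuous c)
    (ht : Continuous t) (hs : Continuous s) :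
    Continuous fun p => orbitKernel φ f (y p) (c p) (t p) (s p) := by
  refine (Complex.continuous_ofReal.comp hc).mul ?_
  exact continuous_eval.comp (((continuous_cc f).comp (hc.mul (ht.sub hs))).prodMk
    (φ.continuous (hc.mul ht) hy))

theorem integrable_cc_norm (f : C_c(ℝ, C(X, ℂ))) : Integrable fun s => ‖f s‖ :=
  ((continuous_cc f).norm).integrable_of_hasCompactSupport (hasCompactSupport_cc f).norm

theorem integrable_regular_integrand (φ : Flow ℝ X) (y : X) {c : ℝ} (f : C_c(ℝ, C(X, ℂ)))
    {ξ : ℝ → ℂ} (hm : StronglyMeasurable ξ) (hξ : Integrable ξ) :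
    Integrable (fun p : ℝ × ℝ => f p.1 (φ (c * p.2) y) * ξ (p.2 - p.1 / c))
      (volume.prod volume) := by
  have hcont : Continuous fun p : ℝ × ℝ => f p.1 (φ (c * p.2) y) :=
    continuous_eval.comp (((continuous_cc f).comp continuous_fst).prodMk
      (φ.continuous (continuous_const.mul continuous_snd) continuous_const))
  have hm2 : StronglyMeasurable fun p : ℝ × ℝ => ξ (p.2 - p.1 / c) :=
    hm.comp_measurable (measurable_snd.sub (measurable_fst.div_const c))
  have hbd : Integrable (fun p : ℝ × ℝ => ‖f p.1‖ * ‖ξ (p.2 - p.1 / c)‖)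
      (volume.prod volume) := by
    have hm3 : StronglyMeasurable fun p : ℝ × ℝ => ‖f p.1‖ * ‖ξ (p.2 - p.1 / c)‖ :=
      ((continuous_cc f).norm.comp continuous_fst).stronglyMeasurable.mul hm2.norm
    rw [integrable_prod_iff hm3.aestronglyMeasurable]
    refine ⟨Filter.Eventually.of_forall fun r =>
      (hξ.norm.comp_sub_right (r / c)).const_mul ‖f r‖, ?_⟩
    refine ((integrable_cc_norm f).mul_const (∫ t, ‖ξ t‖)).congr
      (Filter.Eventually.of_forall fun r => ?_)
    simp only [norm_mul, norm_norm]
    rw [integral_const_mul, integral_sub_right_eq_self (fun t => ‖ξ t‖)]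
  refine hbd.mono' (hcont.stronglyMeasurable.mul hm2).aestronglyMeasurable
    (Filter.Eventually.of_forall fun p => ?_)
  rw [norm_mul]
  exact mul_le_mul_of_nonneg_right ((f p.1).norm_coe_le_norm _) (norm_nonneg _)

theorem integral_orbit_eq (φ : Flow ℝ X) (y : X) {c : ℝ} (hc : 0 < c) (f : C_c(ℝ, C(X, ℂ)))
    (ξ : ℝ → ℂ) (t : ℝ) : ∫ r, f r (φ (c * t) y) * ξ (t - r / c) =
      ∫ s, orbitKernel φ f y c t s * ξ s := by
  have h1 := Measure.integral_comp_mul_left (fun r => f r (φ (c * t) y) * ξ (t - r / c)) c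
  have h2 := integral_sub_left_eq_self
    (fun s => f (c * s) (φ (c * t) y) * ξ (t - c * s / c)) volume t
  rw [abs_of_pos (inv_pos.2 hc)] at h1
  have h3 : ∀ s, orbitKernel φ f y c t s * ξ s =
      (c : ℂ) * (f (c * (t - s)) (φ (c * t) y) * ξ (t - c * (t - s) / c)) := fun s => by
    rw [orbitKernel, mul_assoc, mul_div_cancel_left₀ _ hc.ne', sub_sub_cancel]
  simp only [h3]
  rw [integral_const_mul, h2, h1, Complex.real_smul, ← mul_assoc, ← Complex.ofReal_mul,
    mul_inv_cancel₀ hc.ne', Complex.ofReal_one, one_mul]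

/-- On integrable functions, the regular representation of `f` is the integral operator with the
orbit kernel of `f`. -/
theorem coeFn_regularOp (φ : Flow ℝ X) (y : X) {c : ℝ} (hc : 0 < c) (f : C_c(ℝ, C(X, ℂ)))
    (ξ : L2R) (hξ : Integrable ξ) :
    regularOp φ y hc f ξ =ᵐ[volume] fun t => ∫ s, orbitKernel φ f y c t s * ξ s := by
  have hint := integrable_regular_integrand φ y (c := c) f (Lp.stronglyMeasurable ξ) hξ
  have hintA : ∀ A : Set ℝ, Integrable
      (fun p : ℝ × ℝ => f p.1 (φ (c * p.2) y) * ξ (p.2 - p.1 / c))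
      (volume.prod (volume.restrict A)) := fun A => by
    have : (volume : Measure ℝ).prod (volume.restrict A) =
        (volume.prod volume).restrict (univ ×ˢ A) := by
      rw [← Measure.prod_restrict, Measure.restrict_univ]
    rw [this]
    exact hint.restrict
  refine ae_eq_of_forall_setIntegral_eq_of_sigmaFinite (fun A _ hA => ?_) (fun A _ _ => ?_)
    fun A hAm hA => ?_
  · have : Fact (volume A < ∞) := ⟨hA⟩
    exact ((Lp.memLp (regularOp φ y hc f ξ)).restrict A).integrable (by norm_num)
  · have := (hintA A).integral_prod_right
    simp only [integral_orbit_eq φ y hc f ξ] at this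
    exact this
  · have h1 : ∫ t in A, regularOp φ y hc f ξ t =
        inner ℂ (indicatorConstLp 2 hAm hA.ne (1 : ℂ)) (regularOp φ y hc f ξ) :=
      (L2.inner_indicatorConstLp_one hAm hA.ne _).symm
    have h2 : inner ℂ (indicatorConstLp 2 hAm hA.ne (1 : ℂ)) (regularOp φ y hc f ξ) =
        inner ℂ ((regularIso φ y hc) (indicatorConstLp 2 hAm hA.ne (1 : ℂ)))
          ((regularRep φ y hc).integrated f ((regularIso φ y hc) ξ)) := by
      rw [regularOp, LinearIsometryEquiv.symm_conjStarAlgEquiv_apply_apply,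
        ← (regularIso φ y hc).inner_map_map]
      simp
    rw [h1, h2, CovariantRep.integrated_apply, ← integral_inner
      ((regularRep φ y hc).integrable_integrand f ((regularIso φ y hc) ξ))]
    have h3 : ∀ r, inner ℂ ((regularIso φ y hc) (indicatorConstLp 2 hAm hA.ne (1 : ℂ)))
        ((regularRep φ y hc).π (f r) ((regularRep φ y hc).U r ((regularIso φ y hc) ξ))) =
        ∫ t in A, f r (φ (c * t) y) * ξ (t - r / c) := fun r => by
      rw [regularRep_integrand, (regularIso φ y hc).inner_map_map, L2.inner_indicatorConstLp_one]
      refine integral_congr_ae (ae_restrict_of_ae ?_)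
      filter_upwards [coeFn_orbitRep φ y c (f r) (translation (r / c) ξ),
        coeFn_translationLI (r / c) ξ] with t h4 h5
      rw [h4, translation_apply, h5]
    simp only [h3]
    rw [integral_integral_swap (hintA A)]
    simp only [integral_orbit_eq φ y hc f ξ]

end Regular

/-! ### Compression of the regular representation to one cell -/

theorem memLp_indicator_unit (ξ : L2I) :
    MemLp ((Icc (0 : ℝ) 1).indicator ξ) 2 (volume : Measure ℝ) :=
  (memLp_indicator_iff_restrict measurableSet_Icc).2 (Lp.memLp ξ)

/-- Extension by zero, from `L²([0,1])` to `L²(ℝ)`. -/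
noncomputable def extendL2 : L2I →ₗᵢ[ℂ] L2R where
  toFun ξ := (memLp_indicator_unit ξ).toLp _
  map_add' ξ η := by
    refine Lp.ext ?_
    filter_upwards [(memLp_indicator_unit (ξ + η)).coeFn_toLp, (memLp_indicator_unit ξ).coeFn_toLp,
      (memLp_indicator_unit η).coeFn_toLp, Lp.coeFn_add ((memLp_indicator_unit ξ).toLp _)
        ((memLp_indicator_unit η).toLp _),
      (ae_restrict_iff' measurableSet_Icc).1 (Lp.coeFn_add ξ η)] with t h1 h2 h3 h4 h5
    rw [h1, h4, Pi.add_apply, h2, h3]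
    by_cases ht : t ∈ Icc (0 : ℝ) 1
    · simp only [indicator_of_mem ht, h5 ht, Pi.add_apply]
    · simp only [indicator_of_notMem ht, add_zero]
  map_smul' r ξ := by
    refine Lp.ext ?_
    filter_upwards [(memLp_indicator_unit (r • ξ)).coeFn_toLp, (memLp_indicator_unit ξ).coeFn_toLp,
      Lp.coeFn_smul r ((memLp_indicator_unit ξ).toLp _),
      (ae_restrict_iff' measurableSet_Icc).1 (Lp.coeFn_smul r ξ)] with t h1 h2 h3 h4
    rw [h1, RingHom.id_apply, h3, Pi.smul_apply, h2]
    by_cases ht : t ∈ Icc (0 : ℝ) 1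
    · simp only [indicator_of_mem ht, h4 ht, Pi.smul_apply]
    · simp only [indicator_of_notMem ht, smul_zero]
  norm_map' ξ := by
    change ‖(memLp_indicator_unit ξ).toLp _‖ = ‖ξ‖
    rw [Lp.norm_toLp, Lp.norm_def, eLpNorm_indicator_eq_eLpNorm_restrict measurableSet_Icc]

theorem coeFn_extendL2 (ξ : L2I) : extendL2 ξ =ᵐ[volume] (Icc (0 : ℝ) 1).indicator ξ :=
  (memLp_indicator_unit ξ).coeFn_toLp

/-- Restriction, from `L²(ℝ)` to `L²([0,1])`. -/
noncomputable def restrictL2 : L2R →L[ℂ] L2I :=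
  LpToLpRestrictCLM ℝ ℂ ℂ volume 2 (Icc 0 1)

theorem coeFn_restrictL2 (ξ : L2R) : restrictL2 ξ =ᵐ[unitMeasure] ξ :=
  LpToLpRestrictCLM_coeFn ℂ _ _

theorem inner_extendL2 (η : L2I) (ξ : L2R) : inner ℂ (extendL2 η) ξ = inner ℂ η (restrictL2 ξ) := by
  rw [L2.inner_def, L2.inner_def, ← integral_indicator measurableSet_Icc]
  refine integral_congr_ae ?_
  filter_upwards [coeFn_extendL2 η,
    (ae_restrict_iff' measurableSet_Icc).1 (coeFn_restrictL2 ξ)] with t h1 h2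
  rw [h1]
  by_cases ht : t ∈ Icc (0 : ℝ) 1
  · simp only [indicator_of_mem ht, h2 ht]
  · simp only [indicator_of_notMem ht, inner_zero_left]

theorem inner_restrictL2 (η : L2I) (ξ : L2R) :
    inner ℂ (restrictL2 ξ) η = inner ℂ ξ (extendL2 η) := by
  rw [← inner_conj_symm, ← inner_extendL2, inner_conj_symm]

theorem norm_restrictL2_le : ‖restrictL2‖ ≤ 1 := by
  refine ContinuousLinearMap.opNorm_le_bound _ zero_le_one fun ξ => ?_
  rw [one_mul, Lp.norm_def, Lp.norm_def]
  refine ENNReal.toReal_mono (Lp.eLpNorm_ne_top ξ) ?_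
  rw [eLpNorm_congr_ae (coeFn_restrictL2 ξ)]
  exact eLpNorm_mono_measure _ Measure.restrict_le_self

theorem extendL2_restrictL2 {ξ : L2R} (h : ∀ᵐ t : ℝ, t ∉ Icc (0 : ℝ) 1 → ξ t = 0) :
    extendL2 (restrictL2 ξ) = ξ := by
  refine Lp.ext ?_
  filter_upwards [h, coeFn_extendL2 (restrictL2 ξ),
    (ae_restrict_iff' measurableSet_Icc).1 (coeFn_restrictL2 ξ)] with t h1 h2 h3
  rw [h2]
  by_cases ht : t ∈ Icc (0 : ℝ) 1
  · rw [indicator_of_mem ht, h3 ht]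
  · rw [indicator_of_notMem ht, h1 ht]

theorem integrable_extendL2 (ξ : L2I) : Integrable (extendL2 ξ) := by
  rw [integrable_congr (coeFn_extendL2 ξ), integrable_indicator_iff measurableSet_Icc]
  exact integrable_L2 ξ

section Cell

variable {X : Type u} [TopologicalSpace X] [CompactSpace X] [T2Space X] {φ : Flow ℝ X}

theorem regularOp_add (φ : Flow ℝ X) (y : X) {c : ℝ} (hc : 0 < c) (f g : C_c(ℝ, C(X, ℂ))) :
    regularOp φ y hc (f + g) = regularOp φ y hc f + regularOp φ y hc g := by
  rw [regularOp, CovariantRep.integrated_add, map_add]; rfl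

theorem regularOp_smul (φ : Flow ℝ X) (y : X) {c : ℝ} (hc : 0 < c) (r : ℂ) (f : C_c(ℝ, C(X, ℂ))) :
    regularOp φ y hc (r • f) = r • regularOp φ y hc f := by
  rw [regularOp, CovariantRep.integrated_smul, map_smul]; rfl

theorem regularOp_conv (φ : Flow ℝ X) (y : X) {c : ℝ} (hc : 0 < c) (f g : C_c(ℝ, C(X, ℂ))) :
    regularOp φ y hc (conv φ f g) = regularOp φ y hc f * regularOp φ y hc g := by
  rw [regularOp, CovariantRep.integrated_conv, map_mul]; rfl

theorem regularOp_invol (φ : Flow ℝ X) (y : X) {c : ℝ} (hc : 0 < c) (f : C_c(ℝ, C(X, ℂ))) :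
    regularOp φ y hc (invol φ f) = star (regularOp φ y hc f) := by
  rw [regularOp, CovariantRep.integrated_invol]
  exact (regularIso φ y hc).conjStarAlgEquiv.symm.map_star' _

/-- The compression of the regular representation along the orbit of `y` to the orbit segment from
`y` to `φ_c(y)`, rescaled to an operator on `L²([0,1])`. -/
noncomputable def cellOp (φ : Flow ℝ X) (y : X) {c : ℝ} (hc : 0 < c) (f : C_c(ℝ, C(X, ℂ))) :
    L2I →L[ℂ] L2I :=
  restrictL2 ∘L regularOp φ y hc f ∘L extendL2.toContinuousLinearMap

theorem cellOp_apply (φ : Flow ℝ X) (y : X) {c : ℝ} (hc : 0 < c) (f : C_c(ℝ, C(X, ℂ))) (ξ : L2I) :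
    cellOp φ y hc f ξ = restrictL2 (regularOp φ y hc f (extendL2 ξ)) := rfl

theorem cellOp_add (φ : Flow ℝ X) (y : X) {c : ℝ} (hc : 0 < c) (f g : C_c(ℝ, C(X, ℂ))) :
    cellOp φ y hc (f + g) = cellOp φ y hc f + cellOp φ y hc g := by
  ext1 ξ
  simp only [cellOp_apply, regularOp_add, _root_.add_apply, map_add]

theorem cellOp_smul (φ : Flow ℝ X) (y : X) {c : ℝ} (hc : 0 < c) (r : ℂ) (f : C_c(ℝ, C(X, ℂ))) :
    cellOp φ y hc (r • f) = r • cellOp φ y hc f := by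
  ext1 ξ
  simp only [cellOp_apply, regularOp_smul, _root_.smul_apply, map_smul]

theorem cellOp_invol (φ : Flow ℝ X) (y : X) {c : ℝ} (hc : 0 < c) (f : C_c(ℝ, C(X, ℂ))) :
    cellOp φ y hc (invol φ f) = star (cellOp φ y hc f) := by
  rw [ContinuousLinearMap.star_eq_adjoint, ContinuousLinearMap.eq_adjoint_iff]
  intro ξ η
  rw [cellOp_apply, cellOp_apply, inner_restrictL2, ← inner_extendL2, regularOp_invol,
    ContinuousLinearMap.star_eq_adjoint, ContinuousLinearMap.adjoint_inner_left]

theorem norm_cellOp_le (φ : Flow ℝ X) (y : X) {c : ℝ} (hc : 0 < c) (f : C_c(ℝ, C(X, ℂ))) :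
    ‖cellOp φ y hc f‖ ≤ ‖universalRep φ f‖ := by
  refine le_trans (ContinuousLinearMap.opNorm_le_bound _ (norm_nonneg _) fun ξ => ?_)
    ((norm_regularOp_le φ y hc f).trans (lp.norm_apply_le_norm ENNReal.top_ne_zero
      (universalRep φ f) (regularRep φ y hc)))
  rw [cellOp_apply]
  calc _ ≤ ‖restrictL2‖ * ‖regularOp φ y hc f (extendL2 ξ)‖ := restrictL2.le_opNorm _
    _ ≤ 1 * (‖regularOp φ y hc f‖ * ‖extendL2 ξ‖) := by
        gcongr
        · exact norm_restrictL2_le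
        · exact (regularOp φ y hc f).le_opNorm _
    _ = _ := by rw [one_mul, extendL2.norm_map]

theorem coeFn_regularOp_extendL2 (φ : Flow ℝ X) (y : X) {c : ℝ} (hc : 0 < c)
    (f : C_c(ℝ, C(X, ℂ))) (ξ : L2I) : regularOp φ y hc f (extendL2 ξ) =ᵐ[volume]
      fun t => ∫ s in Icc (0 : ℝ) 1, orbitKernel φ f y c t s * ξ s := by
  filter_upwards [coeFn_regularOp φ y hc f _ (integrable_extendL2 ξ)] with t ht
  rw [ht, ← integral_indicator measurableSet_Icc]
  refine integral_congr_ae ?_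
  filter_upwards [coeFn_extendL2 ξ] with s hs
  rw [hs]
  by_cases h : s ∈ Icc (0 : ℝ) 1
  · simp only [indicator_of_mem h]
  · simp only [indicator_of_notMem h, mul_zero]

theorem isIntegralOp_cellOp (φ : Flow ℝ X) (y : X) {c : ℝ} (hc : 0 < c) (f : C_c(ℝ, C(X, ℂ))) :
    IsIntegralOp (orbitKernel φ f y c) (cellOp φ y hc f) := by
  intro ξ
  filter_upwards [coeFn_restrictL2 (regularOp φ y hc f (extendL2 ξ)),
    ae_restrict_of_ae (coeFn_regularOp_extendL2 φ y hc f ξ)] with t h1 h2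
  rw [cellOp_apply, h1, h2]

/-- The kernel of an element of the block vanishes at `(t, s)` with `t` in the cell, unless `s` is
in the interior of the cell. -/
theorem orbitKernel_eq_zero_of_left {S : Set X} {f : C_c(ℝ, C(X, ℂ))} (hf : f ∈ blockFunctions φ S)
    {y : X} {c : ℝ} (hc : 0 < c) (hy : y ∈ S) (hcy : φ c y ∈ S) {t s : ℝ} (ht : t ∈ Icc (0 : ℝ) 1)
    (hs : s ∉ Ioo (0 : ℝ) 1) : orbitKernel φ f y c t s = 0 := by
  rw [orbitKernel, mul_eq_zero]
  right
  by_cases h0 : s ≤ 0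
  · refine hf _ _ ⟨y, hy, c * t, rfl, Or.inl ⟨mul_nonneg hc.le ht.1, ?_⟩⟩
    exact mul_le_mul_of_nonneg_left (by linarith) hc.le
  · have h1 : 1 ≤ s := by
      by_contra! h1
      exact hs ⟨not_le.1 h0, h1⟩
    refine hf _ _ ⟨φ c y, hcy, c * (t - 1), ?_, Or.inr ⟨?_, ?_⟩⟩
    · rw [← φ.map_add]
      congr 1
      ring
    · exact mul_le_mul_of_nonneg_left (by linarith) hc.le
    · exact mul_nonpos_of_nonneg_of_nonpos hc.le (by linarith [ht.2])

theorem orbitKernel_eq_zero_of_right {S : Set X} {f : C_c(ℝ, C(X, ℂ))}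
    (hf : f ∈ blockFunctions φ S) {y : X} {c : ℝ} (hc : 0 < c) (hy : y ∈ S) (hcy : φ c y ∈ S)
    {t s : ℝ} (hs : s ∈ Icc (0 : ℝ) 1) (ht : t ∉ Ioo (0 : ℝ) 1) : orbitKernel φ f y c t s = 0 := by
  rw [orbitKernel, mul_eq_zero]
  right
  by_cases h0 : t ≤ 0
  · refine hf _ _ ⟨y, hy, c * t, rfl, Or.inr ⟨?_, mul_nonpos_of_nonneg_of_nonpos hc.le h0⟩⟩
    exact mul_le_mul_of_nonneg_left (by linarith [hs.1]) hc.le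
  · have h1 : 1 ≤ t := by
      by_contra! h1
      exact ht ⟨not_le.1 h0, h1⟩
    refine hf _ _ ⟨φ c y, hcy, c * (t - 1), ?_, Or.inl ⟨?_, ?_⟩⟩
    · rw [← φ.map_add]
      congr 1
      ring
    · exact mul_nonneg hc.le (by linarith)
    · exact mul_le_mul_of_nonneg_left (by linarith [hs.2]) hc.le

/-- The regular representation of an element of the block leaves the functions that live on the
cell invariant, so that its compression to the cell is multiplicative. -/
theorem cellOp_conv {S : Set X} (f : C_c(ℝ, C(X, ℂ))) {g : C_c(ℝ, C(X, ℂ))}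
    (hg : g ∈ blockFunctions φ S) {y : X} {c : ℝ} (hc : 0 < c) (hy : y ∈ S) (hcy : φ c y ∈ S) :
    cellOp φ y hc (conv φ f g) = cellOp φ y hc f * cellOp φ y hc g := by
  ext1 ξ
  rw [mul_apply_eq_comp, cellOp_apply, cellOp_apply, cellOp_apply, regularOp_conv,
    mul_apply_eq_comp, extendL2_restrictL2]
  filter_upwards [coeFn_regularOp_extendL2 φ y hc g ξ] with t h1 ht
  rw [h1]
  refine setIntegral_eq_zero_of_forall_eq_zero fun s hs => ?_
  rw [orbitKernel_eq_zero_of_right hg hc hy hcy hs fun h => ht (Ioo_subset_Icc_self h), zero_mul]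

theorem orbitKernel_conv (φ : Flow ℝ X) (f g : C_c(ℝ, C(X, ℂ))) (y : X) {c : ℝ} (hc : 0 < c)
    (t s : ℝ) : orbitKernel φ (conv φ f g) y c t s =
      ∫ u, orbitKernel φ f y c t u * orbitKernel φ g y c u s := by
  rw [← integral_orbit_eq φ y hc f (fun u => orbitKernel φ g y c u s), orbitKernel,
    conv_apply_apply, ← integral_const_mul]
  refine integral_congr_ae (Filter.Eventually.of_forall fun r => ?_)
  have h1 : c * (t - r / c) = -r + c * t := by field_simp; ring
  have h2 : c * (t - r / c - s) = c * (t - s) - r := by field_simp; ring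
  simp only [orbitKernel]
  rw [h1, h2, φ.map_add]
  ring

theorem orbitKernel_conv_of_mem {S : Set X} {f : C_c(ℝ, C(X, ℂ))} (hf : f ∈ blockFunctions φ S)
    (g : C_c(ℝ, C(X, ℂ))) {y : X} {c : ℝ} (hc : 0 < c) (hy : y ∈ S) (hcy : φ c y ∈ S) {t : ℝ}
    (ht : t ∈ Icc (0 : ℝ) 1) (s : ℝ) : orbitKernel φ (conv φ f g) y c t s =
      ∫ u in Icc (0 : ℝ) 1, orbitKernel φ f y c t u * orbitKernel φ g y c u s := by
  rw [orbitKernel_conv φ f g y hc]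
  refine (setIntegral_eq_integral_of_forall_compl_eq_zero fun u hu => ?_).symm
  rw [orbitKernel_eq_zero_of_left hf hc hy hcy ht fun h => hu (Ioo_subset_Icc_self h), zero_mul]

theorem norm_orbitKernel_le {f : C_c(ℝ, C(X, ℂ))} {M : ℝ} (hM : ∀ s, ‖f s‖ ≤ M) (y : X) {c : ℝ}
    (hc : 0 < c) (t s : ℝ) : ‖orbitKernel φ f y c t s‖ ≤ c * M := by
  rw [orbitKernel, norm_mul, Complex.norm_real, Real.norm_of_nonneg hc.le]
  exact mul_le_mul_of_nonneg_left (((f _).norm_coe_le_norm _).trans (hM _)) hc.le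

/-- The kernel of `f * g * f` is bounded by the operator norm of `g`, up to a constant that
depends on `f` only. -/
theorem norm_orbitKernel_conv_conv_le {S : Set X} {f g : C_c(ℝ, C(X, ℂ))}
    (hf : f ∈ blockFunctions φ S) (hg : g ∈ blockFunctions φ S) {M : ℝ} (hM : ∀ s, ‖f s‖ ≤ M)
    {y : X} {c : ℝ} (hc : 0 < c) (hy : y ∈ S) (hcy : φ c y ∈ S) {t : ℝ} (ht : t ∈ Icc (0 : ℝ) 1)
    (s : ℝ) : ‖orbitKernel φ (conv φ f (conv φ g f)) y c t s‖ ≤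
      c * M * ‖cellOp φ y hc g‖ * (c * M) := by
  have h1 : orbitKernel φ (conv φ f (conv φ g f)) y c t s =
      ∫ u in Icc (0 : ℝ) 1, orbitKernel φ f y c t u *
        ∫ v in Icc (0 : ℝ) 1, orbitKernel φ g y c u v * orbitKernel φ f y c v s := by
    rw [orbitKernel_conv_of_mem hf _ hc hy hcy ht]
    refine setIntegral_congr_fun measurableSet_Icc fun u hu => ?_
    rw [orbitKernel_conv_of_mem hg _ hc hy hcy hu]
  rw [h1]
  have hcont : Continuous fun v => orbitKernel φ f y c v s :=
    continuous_orbitKernel φ f continuous_const continuous_const continuous_id continuous_const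
  exact (isIntegralOp_cellOp φ y hc g).norm_integral_integral_le
    (a := fun u => orbitKernel φ f y c t u) (b := fun v => orbitKernel φ f y c v s)
    hcont.measurable (fun u _ => norm_orbitKernel_le hM y hc t u)
    fun v _ => norm_orbitKernel_le hM y hc v s

end Cell

/-! ### The norm of the block -/

/-- A self-adjoint element whose powers satisfy `‖a ^ (n + 3)‖ ≤ C m ^ (n + 1)` has norm at
most `m`, because `‖a‖ ^ N = ‖a ^ N‖` for the powers `N` of two. -/
theorem IsSelfAdjoint.norm_le_of_norm_pow_le {A : Type*} [NormedRing A] [StarRing A] [CStarRing A]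
    {a : A} (ha : IsSelfAdjoint a) {m C : ℝ} (hm : 0 ≤ m)
    (h : ∀ n : ℕ, ‖a ^ (n + 3)‖ ≤ C * m ^ (n + 1)) : ‖a‖ ≤ m := by
  by_contra! hlt
  have h1 : ∀ k : ℕ, ‖a‖ ^ (2 ^ (k + 2)) ≤ C * m ^ (2 ^ (k + 2) - 2) := fun k => by
    have h4 : 4 ≤ 2 ^ (k + 2) := by
      rw [pow_add]
      have := Nat.one_le_two_pow (n := k)
      omega
    have h2 := h (2 ^ (k + 2) - 3)
    rw [show 2 ^ (k + 2) - 3 + 3 = 2 ^ (k + 2) by omega,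
      show 2 ^ (k + 2) - 3 + 1 = 2 ^ (k + 2) - 2 by omega, ha.norm_pow_two_pow] at h2
    exact h2
  have hq : 0 < ‖a‖ := hm.trans_lt hlt
  rcases hm.eq_or_lt with rfl | hm
  · have := h1 0
    norm_num at this
    exact absurd this (not_le.2 (by positivity))
  · obtain ⟨j, hj⟩ := pow_unbounded_of_one_lt (C / ‖a‖ ^ 2) ((one_lt_div hm).2 hlt)
    have h2 := h1 j
    have h3 : j + 2 ≤ 2 ^ (j + 2) := (Nat.lt_two_pow_self).le
    have h5 : 2 ^ (j + 2) = (2 ^ (j + 2) - 2) + 2 := by omega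
    set N := 2 ^ (j + 2) - 2 with hN
    rw [h5, pow_add] at h2
    have h6 : (‖a‖ / m) ^ j ≤ (‖a‖ / m) ^ N :=
      pow_le_pow_right₀ ((one_lt_div hm).2 hlt).le (by omega)
    have h7 : C / ‖a‖ ^ 2 < (‖a‖ / m) ^ N := hj.trans_le h6
    rw [div_pow, div_lt_div_iff₀ (by positivity) (by positivity)] at h7
    linarith

theorem norm_star_mul_self_le {H : Type*} [NormedAddCommGroup H] [InnerProductSpace ℂ H]
    [CompleteSpace H] {T : H →L[ℂ] H} {N : ℝ} (h : ‖T‖ ≤ N) : ‖star T * T‖ ≤ N ^ 2 := by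
  rw [CStarRing.norm_star_mul_self, ← sq]
  exact pow_le_pow_left₀ (norm_nonneg _) h 2

section Norm

variable {X : Type u} [TopologicalSpace X] [CompactSpace X] [T2Space X] {φ : Flow ℝ X}

/-- The convolution powers `f, f * f, f * f * f, …`; the exponent is shifted by one, because the
convolution algebra has no unit. -/
noncomputable def convPow (φ : Flow ℝ X) (f : C_c(ℝ, C(X, ℂ))) : ℕ → C_c(ℝ, C(X, ℂ))
  | 0 => f
  | n + 1 => conv φ f (convPow φ f n)

theorem convPow_mem {S : Set X} {f : C_c(ℝ, C(X, ℂ))} (hf : f ∈ blockFunctions φ S) (n : ℕ) :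
    convPow φ f n ∈ blockFunctions φ S := by
  induction n with
  | zero => exact hf
  | succ n ih => exact conv_mem_blockFunctions hf ih

theorem integrated_convPow (ρ : CovariantRep φ) (f : C_c(ℝ, C(X, ℂ))) (n : ℕ) :
    ρ.integrated (convPow φ f n) = ρ.integrated f ^ (n + 1) := by
  induction n with
  | zero => simp [convPow]
  | succ n ih => rw [convPow, ρ.integrated_conv, ih, pow_succ' _ (n + 1)]

theorem cellOp_convPow {S : Set X} {f : C_c(ℝ, C(X, ℂ))} (hf : f ∈ blockFunctions φ S)
    {y : X} {c : ℝ} (hc : 0 < c) (hy : y ∈ S) (hcy : φ c y ∈ S) (n : ℕ) :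
    cellOp φ y hc (convPow φ f n) = cellOp φ y hc f ^ (n + 1) := by
  induction n with
  | zero => simp [convPow]
  | succ n ih => rw [convPow, cellOp_conv f (convPow_mem hf n) hc hy hcy, ih, pow_succ' _ (n + 1)]

theorem exists_cc_bound (f : C_c(ℝ, C(X, ℂ))) : ∃ M, ∀ s, ‖f s‖ ≤ M :=
  (hasCompactSupport_cc f).exists_bound_of_continuous (continuous_cc f)

namespace IsCrossSection

variable {S : Set X} (hS : IsCrossSection φ S) (hmin : IsMinimal φ)

/-- The operators on `L²([0,1])` given by `f` on the orbit segments between the points `y ∈ S` and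
their first returns. -/
noncomputable def sectionOp (f : C_c(ℝ, C(X, ℂ))) (y : S) : L2I →L[ℂ] L2I :=
  cellOp φ y (hS.arriveTime_pos hmin y.2) f

/-- The key estimate: the `L¹`-norm of `f * g * f` is bounded by the supremum of the operator norms
of `g` on the cells, up to a constant that depends on `f` only. -/
theorem exists_integral_norm_conv_conv_le {f : C_c(ℝ, C(X, ℂ))} (hf : f ∈ blockFunctions φ S) :
    ∃ C, ∀ g ∈ blockFunctions φ S, ∀ N, (∀ y, ‖hS.sectionOp hmin g y‖ ≤ N) →
      ∫ r, ‖conv φ f (conv φ g f) r‖ ≤ C * N := by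
  obtain ⟨M, hM⟩ := exists_cc_bound f
  obtain ⟨T, hT, hTle⟩ := hS.exists_arriveTime_le hmin
  obtain ⟨y₀, hy₀⟩ := hS.nonempty
  refine ⟨2 * T * (T * M ^ 2), fun g hg N hN => ?_⟩
  have hN0 : 0 ≤ N := (norm_nonneg _).trans (hN ⟨y₀, hy₀⟩)
  set F := conv φ f (conv φ g f) with hF
  have hFb : F ∈ blockFunctions φ S := conv_mem_blockFunctions hf (conv_mem_blockFunctions hg hf)
  have key : ∀ r x, F r x = 0 ∨ (r ∈ Icc (-T) T ∧ ‖F r x‖ ≤ T * M ^ 2 * N) := fun r x => by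
    obtain ⟨y, t, ht, rfl⟩ := hS.exists_suspension_eq hmin x
    have hτ := hS.arriveTime_pos hmin y.2
    have hret := hS.flow_arriveTime_mem hmin y.2
    have hτT := hTle y y.2
    have hNy := hN y
    change ‖cellOp φ y hτ g‖ ≤ N at hNy
    change F r (φ (arriveTime φ S y * t) y) = 0 ∨
      (r ∈ Icc (-T) T ∧ ‖F r (φ (arriveTime φ S y * t) y)‖ ≤ T * M ^ 2 * N)
    set c := arriveTime φ S y
    have hval : (c : ℂ) * F r (φ (c * t) y) = orbitKernel φ F y c t (t - r / c) := by
      rw [orbitKernel, sub_sub_cancel, mul_div_cancel₀ _ hτ.ne']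
    by_cases hs : t - r / c ∈ Ioo (0 : ℝ) 1
    · right
      constructor
      · have h1 : |r / c| ≤ 1 := abs_le.2 ⟨by linarith [hs.2, ht.1], by linarith [hs.1, ht.2]⟩
        rw [abs_div, abs_of_pos hτ, div_le_one hτ] at h1
        exact abs_le.1 (h1.trans hτT)
      · have h1 := norm_orbitKernel_conv_conv_le hf hg hM hτ y.2 hret ht (t - r / c)
        rw [← hF, ← hval, norm_mul, Complex.norm_real, Real.norm_of_nonneg hτ.le] at h1
        have h2 : c * ‖F r (φ (c * t) y)‖ ≤ c * (c * M ^ 2 * ‖cellOp φ y hτ g‖) := by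
          refine h1.trans (le_of_eq ?_)
          ring
        refine (le_of_mul_le_mul_left h2 hτ).trans ?_
        gcongr
    · left
      have h1 := orbitKernel_eq_zero_of_left hFb hτ y.2 hret ht hs
      rw [← hval, mul_eq_zero] at h1
      exact h1.resolve_left (Complex.ofReal_ne_zero.2 hτ.ne')
  have hB : 0 ≤ T * M ^ 2 * N := by positivity
  have hzero : ∀ r ∉ Icc (-T) T, ‖F r‖ = 0 := fun r hr => by
    rw [norm_eq_zero]
    ext x
    exact (key r x).resolve_right fun h => hr h.1
  rw [← setIntegral_eq_integral_of_forall_compl_eq_zero hzero]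
  have h1 : ∀ r ∈ Icc (-T) T, ‖‖F r‖‖ ≤ T * M ^ 2 * N := fun r _ => by
    rw [norm_norm, ContinuousMap.norm_le _ hB]
    intro x
    rcases key r x with h | h
    · rw [h, norm_zero]
      exact hB
    · exact h.2
  have h2 := norm_setIntegral_le_of_norm_le_const (μ := volume) (s := Icc (-T) T) (by simp) h1
  refine (Real.le_norm_self _).trans (h2.trans (le_of_eq ?_))
  rw [Measure.real, Real.volume_Icc, ENNReal.toReal_ofReal (by linarith)]
  ring

/-- Every covariant representation is bounded on the block by the norms of the operators on the
cells. For self-adjoint `f` the key estimate, applied to the powers of `f`, bounds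
`‖ρ(f) ^ (n + 3)‖` by a constant times the `n + 1`-st power of the latter. -/
theorem norm_integrated_le (ρ : CovariantRep φ) {f : C_c(ℝ, C(X, ℂ))}
    (hf : f ∈ blockFunctions φ S) {N : ℝ} (hN : ∀ y, ‖hS.sectionOp hmin f y‖ ≤ N) :
    ‖ρ.integrated f‖ ≤ N := by
  obtain ⟨y₀, hy₀⟩ := hS.nonempty
  have hN0 : 0 ≤ N := (norm_nonneg _).trans (hN ⟨y₀, hy₀⟩)
  obtain ⟨h, hh⟩ : ∃ h, h = conv φ (invol φ f) f := ⟨_, rfl⟩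
  have hhb : h ∈ blockFunctions φ S := hh ▸ conv_mem_blockFunctions (invol_mem_blockFunctions hf) hf
  have hρ : ρ.integrated h = star (ρ.integrated f) * ρ.integrated f := by
    rw [hh, ρ.integrated_conv, ρ.integrated_invol]
  have hcell : ∀ y, ‖hS.sectionOp hmin h y‖ ≤ N ^ 2 := fun y => by
    have h1 : hS.sectionOp hmin h y = star (hS.sectionOp hmin f y) * hS.sectionOp hmin f y := by
      unfold sectionOp
      rw [hh, cellOp_conv _ hf _ y.2 (hS.flow_arriveTime_mem hmin y.2), cellOp_invol]
    rw [h1]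
    exact norm_star_mul_self_le (hN y)
  obtain ⟨C, hC⟩ := hS.exists_integral_norm_conv_conv_le hmin hhb
  have hsa : IsSelfAdjoint (ρ.integrated h) := by
    rw [hρ]
    exact IsSelfAdjoint.star_mul_self _
  have h2 : ‖ρ.integrated h‖ ≤ N ^ 2 := by
    refine IsSelfAdjoint.norm_le_of_norm_pow_le hsa (sq_nonneg N) (C := C) fun n => ?_
    have h3 : ρ.integrated h ^ (n + 3) =
        ρ.integrated (conv φ h (conv φ (convPow φ h n) h)) := by
      rw [ρ.integrated_conv, ρ.integrated_conv, integrated_convPow, ← pow_succ, ← pow_succ']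
    rw [h3]
    refine (ρ.norm_integrated_le _).trans (hC _ (convPow_mem hhb n) _ fun y => ?_)
    have h4 : hS.sectionOp hmin (convPow φ h n) y = hS.sectionOp hmin h y ^ (n + 1) :=
      cellOp_convPow hhb _ y.2 (hS.flow_arriveTime_mem hmin y.2) n
    rw [h4]
    exact (norm_pow_le' _ n.succ_pos).trans (pow_le_pow_left₀ (norm_nonneg _) (hcell y) _)
  rw [hρ, CStarRing.norm_star_mul_self, ← sq] at h2
  exact (pow_le_pow_iff_left₀ (norm_nonneg _) hN0 two_ne_zero).1 h2

theorem norm_universalRep_le {f : C_c(ℝ, C(X, ℂ))} (hf : f ∈ blockFunctions φ S) {N : ℝ}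
    (hN : ∀ y, ‖hS.sectionOp hmin f y‖ ≤ N) : ‖universalRep φ f‖ ≤ N := by
  obtain ⟨y₀, hy₀⟩ := hS.nonempty
  exact lp.norm_le_of_forall_le ((norm_nonneg _).trans (hN ⟨y₀, hy₀⟩))
    fun ρ => hS.norm_integrated_le hmin ρ hf hN

theorem norm_sectionOp_le (f : C_c(ℝ, C(X, ℂ))) (y : S) :
    ‖hS.sectionOp hmin f y‖ ≤ ‖universalRep φ f‖ :=
  norm_cellOp_le φ y _ f

theorem isIntegralOp_sectionOp (f : C_c(ℝ, C(X, ℂ))) (y : S) :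
    IsIntegralOp (orbitKernel φ f y (arriveTime φ S y)) (hS.sectionOp hmin f y) :=
  isIntegralOp_cellOp φ y _ f

theorem continuous_sectionOp (f : C_c(ℝ, C(X, ℂ))) : Continuous (hS.sectionOp hmin f) := by
  have hk : Continuous fun p : S × (ℝ × ℝ) =>
      orbitKernel φ f p.1 (arriveTime φ S p.1) p.2.1 p.2.2 :=
    continuous_orbitKernel φ f (continuous_subtype_val.comp continuous_fst)
      ((hS.continuous_arriveTime hmin).comp continuous_fst) (continuous_fst.comp continuous_snd)
      (continuous_snd.comp continuous_snd)
  obtain ⟨M, hM⟩ := exists_cc_bound f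
  rw [continuous_iff_continuousAt]
  intro y
  rw [ContinuousAt, Metric.tendsto_nhds]
  intro ε hε
  have h1 : ∀ᶠ z : S in nhds y, ∀ p ∈ Icc (0 : ℝ) 1 ×ˢ Icc (0 : ℝ) 1,
      ‖orbitKernel φ f z (arriveTime φ S z) p.1 p.2 -
        orbitKernel φ f y (arriveTime φ S y) p.1 p.2‖ < ε / 2 := by
    refine (isCompact_Icc.prod isCompact_Icc).eventually_forall_of_forall_eventually
      fun p _ => ?_
    have h2 : Continuous fun q : S × (ℝ × ℝ) =>
        ‖orbitKernel φ f q.1 (arriveTime φ S q.1) q.2.1 q.2.2 -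
          orbitKernel φ f y (arriveTime φ S y) q.2.1 q.2.2‖ :=
      (hk.sub (hk.comp (continuous_const.prodMk continuous_snd))).norm
    refine h2.continuousAt.eventually_lt continuousAt_const ?_
    simpa using hε
  filter_upwards [h1] with z hz
  rw [dist_eq_norm]
  refine ((hS.isIntegralOp_sectionOp hmin f z).norm_sub_le (hS.isIntegralOp_sectionOp hmin f y)
    (fun t => ?_) (fun t => ?_)
    (fun t _ s _ => norm_orbitKernel_le hM z (hS.arriveTime_pos hmin z.2) t s)
    fun t ht s hs => (hz (t, s) ⟨ht, hs⟩).le).trans_lt (half_lt_self hε)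
  · exact (hk.comp (continuous_const.prodMk (continuous_const.prodMk continuous_id))).measurable
  · exact (hk.comp (continuous_const.prodMk (continuous_const.prodMk continuous_id))).measurable

theorem isCompactOperator_sectionOp (f : C_c(ℝ, C(X, ℂ))) (y : S) :
    IsCompactOperator (hS.sectionOp hmin f y) :=
  (hS.isIntegralOp_sectionOp hmin f y).isCompactOperator
    (continuous_orbitKernel φ f continuous_const continuous_const continuous_fst continuous_snd)

/-- The symbol of `f`: the continuous field of compact operators defined by `f` on the orbit
segments between the points of `S` and their first returns. -/
noncomputable def symbol (f : C_c(ℝ, C(X, ℂ))) : C(S, compactOperators L2I) where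
  toFun y := ⟨hS.sectionOp hmin f y, hS.isCompactOperator_sectionOp hmin f y⟩
  continuous_toFun := (hS.continuous_sectionOp hmin f).subtype_mk _

theorem coe_symbol_apply (f : C_c(ℝ, C(X, ℂ))) (y : S) :
    (hS.symbol hmin f y : L2I →L[ℂ] L2I) = hS.sectionOp hmin f y := rfl

theorem symbol_add (f g : C_c(ℝ, C(X, ℂ))) :
    hS.symbol hmin (f + g) = hS.symbol hmin f + hS.symbol hmin g :=
  ContinuousMap.ext fun y => Subtype.ext (cellOp_add φ y _ f g)

theorem symbol_smul (r : ℂ) (f : C_c(ℝ, C(X, ℂ))) :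
    hS.symbol hmin (r • f) = r • hS.symbol hmin f :=
  ContinuousMap.ext fun y => Subtype.ext (cellOp_smul φ y _ r f)

theorem symbol_zero : hS.symbol hmin 0 = 0 := by
  refine ContinuousMap.ext fun y => Subtype.ext ?_
  have h := cellOp_smul φ y (hS.arriveTime_pos hmin y.2) 0 0
  rwa [zero_smul, zero_smul] at h

theorem symbol_conv (f : C_c(ℝ, C(X, ℂ))) {g : C_c(ℝ, C(X, ℂ))} (hg : g ∈ blockFunctions φ S) :
    hS.symbol hmin (conv φ f g) = hS.symbol hmin f * hS.symbol hmin g :=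
  ContinuousMap.ext fun y => Subtype.ext
    (cellOp_conv f hg _ y.2 (hS.flow_arriveTime_mem hmin y.2))

theorem symbol_invol (f : C_c(ℝ, C(X, ℂ))) :
    hS.symbol hmin (invol φ f) = star (hS.symbol hmin f) :=
  ContinuousMap.ext fun y => Subtype.ext (cellOp_invol φ y _ f)

theorem norm_symbol [CompactSpace S] {f : C_c(ℝ, C(X, ℂ))} (hf : f ∈ blockFunctions φ S) :
    ‖hS.symbol hmin f‖ = ‖universalRep φ f‖ :=
  le_antisymm ((ContinuousMap.norm_le _ (norm_nonneg _)).2 (hS.norm_sectionOp_le hmin f))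
    (hS.norm_universalRep_le hmin hf (hS.symbol hmin f).norm_coe_le_norm)

end IsCrossSection

end Norm

/-! ### Elementary kernels in the block -/

/-- On a Hilbert space, compact operators are limits of operators of finite rank: project the
range to the span of a finite `ε`-net of the image of the unit ball. -/
theorem IsCompactOperator.mem_closure_span_rankOne {H : Type*} [NormedAddCommGroup H]
    [InnerProductSpace ℂ H] [CompleteSpace H] {T : H →L[ℂ] H} (hT : IsCompactOperator T) :
    T ∈ closure (Submodule.span ℂ
      {R : H →L[ℂ] H | ∃ v w, InnerProductSpace.rankOne ℂ v w = R} : Set (H →L[ℂ] H)) := by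
  rw [Metric.mem_closure_iff]
  intro ε hε
  have htb : TotallyBounded (T '' Metric.closedBall 0 1) :=
    (IsCompactOperator.isCompact_closure_image_closedBall
      (f := (T : H →ₗ[ℂ] H)) hT 1).totallyBounded.subset subset_closure
  obtain ⟨F, -, hF, hcov⟩ := Metric.finite_approx_of_totallyBounded htb (ε / 2) (by positivity)
  let V : Submodule ℂ H := Submodule.span ℂ F
  have : FiniteDimensional ℂ V := FiniteDimensional.span_of_finite ℂ hF
  refine ⟨V.starProjection ∘L T, ?_, ?_⟩
  · rw [OrthonormalBasis.starProjection_eq_sum_rankOne (stdOrthonormalBasis ℂ V),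
      ContinuousLinearMap.finsetSum_comp]
    refine Submodule.sum_mem _ fun i _ => Submodule.subset_span ⟨_, _,
      (InnerProductSpace.rankOne_comp _ _ T).symm⟩
  · rw [dist_eq_norm]
    refine lt_of_le_of_lt (ContinuousLinearMap.opNorm_le_of_unit_norm (C := ε / 2)
      (by positivity) fun ξ hξ => ?_) (half_lt_self hε)
    obtain ⟨v, hv, hd⟩ := mem_iUnion₂.1 (hcov ⟨ξ, by simp [hξ], rfl⟩)
    rw [_root_.sub_apply, ContinuousLinearMap.comp_apply]
    have h1 := V.starProjection_minimal (T ξ)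
    rw [h1]
    refine (ciInf_le ⟨0, ?_⟩ (⟨v, Submodule.subset_span hv⟩ : V)).trans ?_
    · rintro _ ⟨w, rfl⟩
      exact norm_nonneg _
    · rw [← dist_eq_norm]
      exact (Metric.mem_ball.1 hd).le

/-- The classes in `L²([0,1])` of the continuous functions on `ℝ` that vanish outside `(0,1)`. -/
def continuousVanishing : Submodule ℂ L2I where
  carrier := {ξ | ∃ a : ℝ → ℂ, Continuous a ∧ (∀ t ∉ Ioo (0 : ℝ) 1, a t = 0) ∧
    ξ =ᵐ[unitMeasure] a}
  add_mem' := by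
    rintro ξ η ⟨a, ha, ha0, hξ⟩ ⟨b, hb, hb0, hη⟩
    refine ⟨fun t => a t + b t, ha.add hb, fun t ht => by
      simp only [ha0 t ht, hb0 t ht, add_zero], ?_⟩
    filter_upwards [Lp.coeFn_add ξ η, hξ, hη] with t h1 h2 h3
    rw [h1, Pi.add_apply, h2, h3]
  zero_mem' := ⟨fun _ => 0, continuous_const, fun _ _ => rfl, Lp.coeFn_zero _ _ _⟩
  smul_mem' := by
    rintro c ξ ⟨a, ha, ha0, hξ⟩
    refine ⟨fun t => c * a t, continuous_const.mul ha, fun t ht => by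
      simp only [ha0 t ht, mul_zero], ?_⟩
    filter_upwards [Lp.coeFn_smul c ξ, hξ] with t h1 h2
    rw [h1, Pi.smul_apply, h2, smul_eq_mul]

theorem dense_continuousVanishing : Dense (continuousVanishing : Set L2I) := by
  rw [Submodule.dense_iff_topologicalClosure_eq_top, Submodule.topologicalClosure_eq_top_iff,
    Submodule.eq_bot_iff]
  intro ξ hξ
  rw [Submodule.mem_orthogonal] at hξ
  have hint : IntegrableOn ξ (Icc (0 : ℝ) 1) := integrable_L2 ξ
  have h1 : ∀ᵐ t : ℝ, t ∈ Ioo (0 : ℝ) 1 → ξ t = 0 := by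
    refine isOpen_Ioo.ae_eq_zero_of_integral_contDiff_smul_eq_zero
      (hint.mono_set Ioo_subset_Icc_self).locallyIntegrableOn fun g hg hgc hgs => ?_
    have hg0 : ∀ t ∉ Ioo (0 : ℝ) 1, (g t : ℂ) = 0 := fun t ht => by
      rw [image_eq_zero_of_notMem_tsupport fun h => ht (hgs h), Complex.ofReal_zero]
    have hcont : Continuous fun t => (g t : ℂ) := Complex.continuous_ofReal.comp hg.continuous
    obtain ⟨C, hC⟩ := hgc.exists_bound_of_continuous hg.continuous
    have hL : MemLp (fun t => (g t : ℂ)) 2 unitMeasure :=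
      memLp_of_bound_unit hcont.measurable (C := C) fun t _ => by
        rw [Complex.norm_real]
        exact hC t
    have h2 := hξ (hL.toLp _) ⟨_, hcont, hg0, hL.coeFn_toLp⟩
    rw [L2.inner_def] at h2
    rw [← h2, ← setIntegral_eq_integral_of_forall_compl_eq_zero (s := Icc (0 : ℝ) 1)]
    · refine integral_congr_ae ?_
      filter_upwards [hL.coeFn_toLp] with t ht
      rw [ht]
      simp [mul_comm]
    · intro t ht
      have := hg0 t fun h => ht (Ioo_subset_Icc_self h)
      rw [Complex.ofReal_eq_zero] at this
      rw [this, zero_smul]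
  refine Lp.ext ?_
  have h2 : ∀ᵐ t ∂unitMeasure, t ∈ Ioo (0 : ℝ) 1 := by
    rw [unitMeasure, ← restrict_Ioo_eq_restrict_Icc]
    exact ae_restrict_mem measurableSet_Ioo
  filter_upwards [ae_restrict_of_ae h1, h2, Lp.coeFn_zero ℂ 2 unitMeasure] with t h3 h4 h5
  rw [h3 h4, h5, Pi.zero_apply]

namespace IsCrossSection

variable {X : Type u} [TopologicalSpace X] [CompactSpace X] [T2Space X] {φ : Flow ℝ X}
  {S : Set X} (hS : IsCrossSection φ S) (hmin : IsMinimal φ)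
include hS hmin

/-- The suspension map, with the time as a parameter, is a quotient map. -/
theorem isQuotientMap_suspension : Topology.IsQuotientMap
    (Prod.map id fun p : S × Icc (0 : ℝ) 1 => suspension φ S (p.1, p.2) :
      ℝ × (S × Icc (0 : ℝ) 1) → ℝ × X) := by
  have : CompactSpace S := isCompact_iff_compactSpace.1 hS.isCompact
  have hq : Continuous fun p : S × Icc (0 : ℝ) 1 => suspension φ S (p.1, p.2) :=
    (hS.continuous_suspension hmin).comp
      (continuous_fst.prodMk (continuous_subtype_val.comp continuous_snd))
  have hp := (isProperMap_id (X := ℝ)).prodMap hq.isProperMap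
  refine hp.isClosedMap.isQuotientMap hp.continuous (Function.surjective_id.prodMap fun x => ?_)
  obtain ⟨y, t, ht, h⟩ := hS.exists_suspension_eq hmin x
  exact ⟨(y, ⟨t, ht⟩), h⟩

/-- Every elementary kernel `g(y) a(t) b(s)` is the kernel of an element of the block: in suspension
coordinates, this element is `f(r)(y, t) = τ(y)⁻¹ g(y) a(t) b(t - r / τ(y))`. -/
theorem exists_mem_blockFunctions_orbitKernel_eq (g : C(S, ℂ)) {a b : ℝ → ℂ} (ha : Continuous a)
    (hb : Continuous b) (ha0 : ∀ t ∉ Ioo (0 : ℝ) 1, a t = 0) (hb0 : ∀ t ∉ Ioo (0 : ℝ) 1, b t = 0) :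
    ∃ f ∈ blockFunctions φ S, ∀ y : S, ∀ t ∈ Icc (0 : ℝ) 1, ∀ s,
      orbitKernel φ f y (arriveTime φ S y) t s = g y * (a t * b s) := by
  let F : C(ℝ × (S × Icc (0 : ℝ) 1), ℂ) :=
    ⟨fun p => ((arriveTime φ S p.2.1 : ℂ)⁻¹ * g p.2.1) *
        (a p.2.2 * b (p.2.2 - p.1 / arriveTime φ S p.2.1)), by
      have hτ : Continuous fun p : ℝ × (S × Icc (0 : ℝ) 1) => arriveTime φ S p.2.1 :=
        (hS.continuous_arriveTime hmin).comp (continuous_fst.comp continuous_snd)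
      have hτ0 : ∀ p : ℝ × (S × Icc (0 : ℝ) 1), arriveTime φ S p.2.1 ≠ 0 := fun p =>
        (hS.arriveTime_pos hmin p.2.1.2).ne'
      have ht : Continuous fun p : ℝ × (S × Icc (0 : ℝ) 1) => (p.2.2 : ℝ) :=
        continuous_subtype_val.comp (continuous_snd.comp continuous_snd)
      refine ((Complex.continuous_ofReal.comp hτ).inv₀ fun p => ?_).mul
        (g.continuous.comp (continuous_fst.comp continuous_snd)) |>.mul
        ((ha.comp ht).mul (hb.comp (ht.sub (continuous_fst.div hτ hτ0))))
      exact Complex.ofReal_ne_zero.2 (hτ0 p)⟩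
  have hfac : Function.FactorsThrough F
      (Prod.map id fun p : S × Icc (0 : ℝ) 1 => suspension φ S (p.1, p.2)) := by
    rintro ⟨r, y, t⟩ ⟨r', y', t'⟩ h
    obtain ⟨rfl, h2⟩ : r = r' ∧ suspension φ S (y, t) = suspension φ S (y', t') :=
      Prod.ext_iff.1 h
    by_cases ht : (t : ℝ) ∈ Ioo (0 : ℝ) 1
    · obtain ⟨rfl, h3⟩ := hS.suspension_injective hmin ht t'.2 h2
      rw [Subtype.ext h3]
    · by_cases ht' : (t' : ℝ) ∈ Ioo (0 : ℝ) 1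
      · obtain ⟨rfl, h3⟩ := hS.suspension_injective hmin ht' t.2 h2.symm
        rw [Subtype.ext h3]
      · simp only [F, ContinuousMap.coe_mk, ha0 _ ht, ha0 _ ht', zero_mul, mul_zero]
  let q : C(ℝ × (S × Icc (0 : ℝ) 1), ℝ × X) := ⟨_, (hS.isQuotientMap_suspension hmin).continuous⟩
  have hq : Topology.IsQuotientMap q := hS.isQuotientMap_suspension hmin
  let G : C(ℝ × X, ℂ) := hq.lift F hfac
  have hG : ∀ r (y : S) (t : ℝ), t ∈ Icc (0 : ℝ) 1 → G (r, suspension φ S (y, t)) =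
      ((arriveTime φ S y : ℂ)⁻¹ * g y) * (a t * b (t - r / arriveTime φ S y)) :=
    fun r y t ht => congrArg (fun k : C(ℝ × (S × Icc (0 : ℝ) 1), ℂ) => k (r, y, ⟨t, ht⟩))
      (hq.lift_comp F hfac)
  obtain ⟨T, hT, hTle⟩ := hS.exists_arriveTime_le hmin
  have hsupp : HasCompactSupport G.curry := by
    refine HasCompactSupport.intro (isCompact_Icc (a := -T) (b := T)) fun r hr => ?_
    ext x
    obtain ⟨y, t, ht, rfl⟩ := hS.exists_suspension_eq hmin x
    have hτ := hS.arriveTime_pos hmin y.2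
    rw [ContinuousMap.curry_apply, hG r y t ht, hb0, mul_zero, mul_zero, ContinuousMap.zero_apply]
    intro hs
    have h1 : |r / arriveTime φ S y| ≤ 1 :=
      abs_le.2 ⟨by linarith [hs.2, ht.1], by linarith [hs.1, ht.2]⟩
    rw [abs_div, abs_of_pos hτ, div_le_one hτ] at h1
    exact hr (abs_le.1 (h1.trans (hTle y y.2)))
  let f : C_c(ℝ, C(X, ℂ)) := ⟨G.curry, hsupp⟩
  have hf : ∀ r x, f r x = G (r, x) := fun r x => rfl
  refine ⟨f, ?_, fun y t ht s => ?_⟩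
  · rintro x s ⟨y, hy, t, rfl, hts⟩
    obtain ⟨z, v, hv, hzv⟩ := hS.exists_suspension_eq hmin (φ t y)
    have hτ := hS.arriveTime_pos hmin z.2
    rw [hf, ← hzv, hG s z v hv]
    by_cases hv' : v ∈ Ioo (0 : ℝ) 1
    · rw [hb0, mul_zero, mul_zero]
      have h1 : φ (arriveTime φ S z * v - t) (z : X) ∈ S := by
        rwa [flow_sub_of_eq (show φ (arriveTime φ S z * v) (z : X) = φ t y from hzv)]
      have h2 : 0 < arriveTime φ S z * v - t →
          arriveTime φ S z ≤ arriveTime φ S z * v - t := fun h => arriveTime_le h h1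
      have h3 : arriveTime φ S z * v < arriveTime φ S z := by nlinarith [hv'.2]
      have h4 : 0 < arriveTime φ S z * v := mul_pos hτ hv'.1
      rintro ⟨h5, h6⟩
      rcases hts with ⟨h0, hts⟩ | ⟨hts, h0⟩
      · have h7 : arriveTime φ S z * v ≤ t := by
          by_contra! h
          linarith [h2 (by linarith)]
        have h8 : s / arriveTime φ S z < v := by linarith
        rw [div_lt_iff₀ hτ] at h8
        linarith
      · have h7 := h2 (by linarith)
        have h8 : v - 1 < s / arriveTime φ S z := by linarith
        rw [lt_div_iff₀ hτ] at h8
        linarith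
    · rw [ha0 v hv', zero_mul, mul_zero]
  · have hτ := hS.arriveTime_pos hmin y.2
    have h1 := hG (arriveTime φ S y * (t - s)) y t ht
    rw [orbitKernel, hf]
    change G (_, φ (arriveTime φ S y * t) y) = _ at h1
    rw [h1, mul_div_cancel_left₀ _ hτ.ne', sub_sub_cancel, mul_assoc _ (g y),
      mul_inv_cancel_left₀ (Complex.ofReal_ne_zero.2 hτ.ne')]

end IsCrossSection

/-! ### Total families in continuous fields of compact operators -/

section Fields

variable {S : Type*} [TopologicalSpace S] {E : Type*} [NormedAddCommGroup E] [NormedSpace ℂ E]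

/-- The continuous field `y ↦ g(y) v`. -/
noncomputable def elementaryField (g : C(S, ℂ)) (v : E) : C(S, E) :=
  ⟨fun y => g y • v, g.continuous.smul continuous_const⟩

theorem continuous_elementaryField (g : C(S, ℂ)) :
    Continuous (elementaryField g : E → C(S, E)) :=
  ContinuousMap.continuous_of_continuous_uncurry _
    ((g.continuous.comp continuous_snd).smul continuous_fst)

/-- The elementary fields with vectors from a set with dense span are total in `C(S, E)`. Total
disconnectedness provides partitions of unity by indicator functions of clopen sets. -/
theorem mem_of_elementaryField_mem [CompactSpace S] [T2Space S] [TotallyDisconnectedSpace S]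
    {Q : Submodule ℂ C(S, E)} (hQ : IsClosed (Q : Set C(S, E))) {D : Set E}
    (hD : Dense (Submodule.span ℂ D : Set E))
    (h : ∀ g : C(S, ℂ), ∀ v ∈ D, elementaryField g v ∈ Q) (F : C(S, E)) : F ∈ Q := by
  have h1 : ∀ (g : C(S, ℂ)) (v : E), elementaryField g v ∈ Q := fun g v => by
    have hclosed : IsClosed {v : E | elementaryField g v ∈ Q} :=
      hQ.preimage (continuous_elementaryField g)
    refine closure_minimal (fun v hv => ?_) hclosed (hD v)
    induction hv using Submodule.span_induction with
    | mem v hv => exact h g v hv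
    | zero =>
      have : elementaryField g (0 : E) = 0 := ContinuousMap.ext fun y => smul_zero (g y)
      change elementaryField g 0 ∈ Q
      rw [this]
      exact Q.zero_mem
    | add v w _ _ hv hw =>
      have : elementaryField g (v + w) = elementaryField g v + elementaryField g w :=
        ContinuousMap.ext fun y => smul_add (g y) v w
      change elementaryField g (v + w) ∈ Q
      rw [this]
      exact Q.add_mem hv hw
    | smul c v _ hv =>
      have : elementaryField g (c • v) = c • elementaryField g v :=
        ContinuousMap.ext fun y => smul_comm (g y) c v
      change elementaryField g (c • v) ∈ Q
      rw [this]
      exact Q.smul_mem c hv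
  refine hQ.closure_subset (Metric.mem_closure_iff.2 fun ε hε => ?_)
  obtain ⟨n, g, v, hgv⟩ := ContinuousMap.exists_finite_sum_smul_approximation_of_mem_uniformity
    (R := ℂ) (F.comp ContinuousMap.fst : C(S × Unit, E)) (Metric.dist_mem_uniformity (half_pos hε))
  refine ⟨∑ i, elementaryField (g i) (v i ()), Q.sum_mem fun i _ => h1 (g i) (v i ()), ?_⟩
  refine lt_of_le_of_lt ((ContinuousMap.dist_le (half_pos hε).le).2 fun y => ?_) (half_lt_self hε)
  rw [ContinuousMap.sum_apply]
  exact (hgv y ()).le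

end Fields

section RankOne

variable {H : Type*} [NormedAddCommGroup H] [InnerProductSpace ℂ H] [CompleteSpace H]

/-- The operator `ξ ↦ ⟨w, ξ⟩ v`, as a compact operator. -/
noncomputable def compactRankOne (v w : H) : compactOperators H :=
  ⟨InnerProductSpace.rankOne ℂ v w, isCompactOperator_rankOne v w⟩

set_option synthInstance.maxHeartbeats 200000 in
/-- The operators of rank one with vectors from a dense subset of `H` are total in the compact
operators. -/
theorem dense_span_compactRankOne {D : Set H} (hD : Dense D) :
    Dense (Submodule.span ℂ (image2 compactRankOne D D) : Set (compactOperators H)) := by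
  have hcont : Continuous fun p : H × H => InnerProductSpace.rankOne ℂ p.1 p.2 :=
    ((ContinuousLinearMap.smulRightL ℂ H H).continuous.comp
      ((innerSL ℂ).continuous.comp continuous_snd)).clm_apply continuous_fst
  set P := Submodule.span ℂ (image2 compactRankOne D D : Set (compactOperators H)) with hP
  have h1 : ∀ v w : H, compactRankOne v w ∈ P.topologicalClosure := fun v w => by
    have hclosed : IsClosed {p : H × H | compactRankOne p.1 p.2 ∈ P.topologicalClosure} :=
      P.isClosed_topologicalClosure.preimage (Continuous.subtype_mk hcont _)
    have hsub : D ×ˢ D ⊆ {p : H × H | compactRankOne p.1 p.2 ∈ P.topologicalClosure} :=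
      fun p hp => P.le_topologicalClosure (Submodule.subset_span ⟨_, hp.1, _, hp.2, rfl⟩)
    exact closure_minimal hsub hclosed ((hD.prod hD) (v, w))
  have h2 : ∀ R ∈ Submodule.span ℂ {R : H →L[ℂ] H | ∃ v w, InnerProductSpace.rankOne ℂ v w = R},
      ∃ hR : IsCompactOperator R, (⟨R, hR⟩ : compactOperators H) ∈ P.topologicalClosure :=
    fun R hR => by
    induction hR using Submodule.span_induction with
    | mem R hR =>
      obtain ⟨v, w, rfl⟩ := hR
      exact ⟨_, h1 v w⟩
    | zero => exact ⟨isCompactOperator_zero, P.topologicalClosure.zero_mem⟩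
    | add R R' _ _ h h' =>
      obtain ⟨hR, h⟩ := h
      obtain ⟨hR', h'⟩ := h'
      exact ⟨hR.add hR', P.topologicalClosure.add_mem h h'⟩
    | smul c R _ h =>
      obtain ⟨hR, h⟩ := h
      exact ⟨hR.smul c, P.topologicalClosure.smul_mem c h⟩
  intro T
  refine P.isClosed_topologicalClosure.closure_subset (Metric.mem_closure_iff.2 fun ε hε => ?_)
  obtain ⟨R, hR, hd⟩ := Metric.mem_closure_iff.1
    (IsCompactOperator.mem_closure_span_rankOne T.2) ε hε
  obtain ⟨hRc, hRQ⟩ := h2 R hR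
  exact ⟨⟨R, hRc⟩, hRQ, hd⟩

end RankOne

namespace IsCrossSection

variable {X : Type u} [TopologicalSpace X] [CompactSpace X] [T2Space X] {φ : Flow ℝ X}
  {S : Set X} (hS : IsCrossSection φ S) (hmin : IsMinimal φ)

set_option synthInstance.maxHeartbeats 200000 in
/-- The field `y ↦ g(y) ⟨w, ·⟩ v` is given by the kernels `g(y) v(t) conj (w(s))` on the cells, so
it is a symbol, if `v` and `w` are continuous and vanish at `0` and `1`. -/
theorem exists_symbol_eq_elementaryField (g : C(S, ℂ)) {v w : L2I}
    (hv : v ∈ continuousVanishing) (hw : w ∈ continuousVanishing) :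
    ∃ f ∈ blockFunctions φ S, hS.symbol hmin f = elementaryField g (compactRankOne v w) := by
  obtain ⟨a, ha, ha0, hva⟩ := hv
  obtain ⟨b, hb, hb0, hwb⟩ := hw
  -- the second factor of the kernel is conjugated, as `⟨w, ξ⟩` is conjugate linear in `w`
  obtain ⟨f, hf, hk⟩ := hS.exists_mem_blockFunctions_orbitKernel_eq hmin g ha
    (continuous_star.comp hb) ha0 (fun t ht => by simp [hb0 t ht])
  refine ⟨f, hf, ContinuousMap.ext fun y => Subtype.ext ?_⟩
  have h1 := (hS.isIntegralOp_sectionOp hmin f y).congr fun t ht s _ => hk y t ht s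
  have hsb : star (star ∘ b) = b := by
    funext t
    simp
  obtain ⟨A, hA⟩ := isCompact_Icc.exists_bound_of_continuousOn (s := Icc (0 : ℝ) 1) ha.continuousOn
  obtain ⟨B, hB⟩ := isCompact_Icc.exists_bound_of_continuousOn (s := Icc (0 : ℝ) 1) hb.continuousOn
  have haL : MemLp a 2 unitMeasure := memLp_of_bound_unit ha.measurable hA
  have hbL : MemLp (star (star ∘ b)) 2 unitMeasure := by
    rw [hsb]
    exact memLp_of_bound_unit hb.measurable hB
  have hv : haL.toLp a = v := Lp.ext (haL.coeFn_toLp.trans hva.symm)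
  have hw : hbL.toLp _ = w := by
    refine Lp.ext (hbL.coeFn_toLp.trans ?_)
    rw [hsb]
    exact hwb.symm
  have h2 := (IsIntegralOp.rankOne haL hbL).smul (g y)
  rw [hv, hw] at h2
  have hA0 : 0 ≤ A := (norm_nonneg _).trans (hA 0 ⟨le_rfl, zero_le_one⟩)
  have h3 := h1.norm_sub_le h2 (fun t => ?_) (fun t => ?_) (C := ‖g y‖ * (A * B)) (ε := 0)
    (fun t ht s hs => ?_) fun t ht s hs => by simp
  · rw [coe_symbol_apply]
    exact sub_eq_zero.1 (norm_le_zero_iff.1 h3)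
  · exact (continuous_const.mul (continuous_const.mul (continuous_star.comp hb))).measurable
  · exact (continuous_const.mul (continuous_const.mul (continuous_star.comp hb))).measurable
  · rw [norm_mul, norm_mul]
    refine mul_le_mul_of_nonneg_left (mul_le_mul (hA t ht) ?_ (norm_nonneg _) hA0) (norm_nonneg _)
    simpa using hB s hs

end IsCrossSection

/-! ### Isometries between dense subalgebras -/

/-- Two maps `α`, `β` from a set with operations into `A` and `B` that are compatible with these
operations and satisfy `‖α i‖ = ‖β i‖` induce an isometric `*`-isomorphism from the closure of the
range of `α` onto `B`, if the range of `β` is dense: the closure of `{(α i, β i)}` is the graph of a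
map, and it projects isometrically, hence with closed range, to both factors. The operations on the
index set are only required to exist pointwise. -/
theorem exists_starAlgEquiv_of_norm_eq {A B ι : Type*} [NonUnitalCStarAlgebra A]
    [NormedAddCommGroup B] [NormedSpace ℂ B] [CompleteSpace B] [Mul B] [ContinuousMul B] [Star B]
    [ContinuousStar B] (α : ι → A) (β : ι → B) (hzero : ∃ k, α k = 0 ∧ β k = 0)
    (hadd : ∀ i j, ∃ k, α k = α i + α j ∧ β k = β i + β j)
    (hsmul : ∀ (c : ℂ) i, ∃ k, α k = c • α i ∧ β k = c • β i)
    (hmul : ∀ i j, ∃ k, α k = α i * α j ∧ β k = β i * β j)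
    (hstar : ∀ i, ∃ k, α k = star (α i) ∧ β k = star (β i))
    (hnorm : ∀ i, ‖α i‖ = ‖β i‖) (I : NonUnitalStarSubalgebra ℂ A)
    (hI : (I : Set A) = closure (range α)) (hdense : Dense (range β)) :
    ∃ e : I ≃⋆ₐ[ℂ] B, (∀ a, ‖e a‖ = ‖a‖) ∧ ∀ i, ∀ h : α i ∈ I, e ⟨α i, h⟩ = β i := by
  let G : Submodule ℂ (A × B) :=
    { carrier := range fun i => (α i, β i)
      add_mem' := by
        rintro _ _ ⟨i, rfl⟩ ⟨j, rfl⟩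
        obtain ⟨k, h, h'⟩ := hadd i j
        exact ⟨k, Prod.ext h h'⟩
      zero_mem' := by
        obtain ⟨k, h, h'⟩ := hzero
        exact ⟨k, Prod.ext h h'⟩
      smul_mem' := by
        rintro c _ ⟨i, rfl⟩
        obtain ⟨k, h, h'⟩ := hsmul c i
        exact ⟨k, Prod.ext h h'⟩ }
  set Γ := G.topologicalClosure with hΓ
  have hΓc : IsClosed (Γ : Set (A × B)) := Submodule.isClosed_topologicalClosure _
  have hle : G ≤ Γ := G.le_topologicalClosure
  have hΓnorm : ∀ p ∈ Γ, ‖p.1‖ = ‖p.2‖ := fun p hp =>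
    closure_minimal (by rintro _ ⟨i, rfl⟩; exact hnorm i)
      (isClosed_eq continuous_fst.norm continuous_snd.norm) hp
  have hΓmul : ∀ p ∈ Γ, ∀ q ∈ Γ, p * q ∈ Γ := fun p hp q hq =>
    map_mem_closure₂ continuous_mul hp hq (by
      rintro _ ⟨i, rfl⟩ _ ⟨j, rfl⟩
      obtain ⟨k, h, h'⟩ := hmul i j
      exact ⟨k, Prod.ext h h'⟩)
  have hΓstar : ∀ p ∈ Γ, star p ∈ Γ := fun p hp => map_mem_closure continuous_star hp (by
    rintro _ ⟨i, rfl⟩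
    obtain ⟨k, h, h'⟩ := hstar i
    exact ⟨k, Prod.ext h h'⟩)
  have : CompleteSpace Γ := hΓc.completeSpace_coe
  have hsub : ∀ p q : Γ, ‖(p : A × B).1 - (q : A × B).1‖ = ‖(p : A × B).2 - (q : A × B).2‖ :=
    fun p q => hΓnorm _ (Γ.sub_mem p.2 q.2)
  have hfst : Isometry fun p : Γ => (p : A × B).1 := Isometry.of_dist_eq fun p q => by
    rw [Subtype.dist_eq, Prod.dist_eq, dist_eq_norm, dist_eq_norm, ← hsub, max_self]
  have hsnd : Isometry fun p : Γ => (p : A × B).2 := Isometry.of_dist_eq fun p q => by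
    rw [Subtype.dist_eq, Prod.dist_eq, dist_eq_norm, dist_eq_norm, hsub, max_self]
  have hA : ∀ a, a ∈ I ↔ ∃ b, (a, b) ∈ Γ := fun a => by
    rw [← SetLike.mem_coe, hI]
    constructor
    · intro ha
      obtain ⟨⟨⟨a', b⟩, hp⟩, rfl⟩ := closure_minimal (t := range fun p : Γ => (p : A × B).1)
        (by rintro _ ⟨i, rfl⟩; exact ⟨⟨_, hle ⟨i, rfl⟩⟩, rfl⟩)
        hfst.isClosedEmbedding.isClosed_range ha
      exact ⟨b, hp⟩
    · rintro ⟨b, hb⟩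
      exact map_mem_closure continuous_fst hb (by rintro _ ⟨i, rfl⟩; exact ⟨i, rfl⟩)
  have hB : ∀ b, ∃ a, (a, b) ∈ Γ := fun b => by
    obtain ⟨⟨⟨a, b'⟩, hp⟩, rfl⟩ := closure_minimal (t := range fun p : Γ => (p : A × B).2)
      (by rintro _ ⟨i, rfl⟩; exact ⟨⟨_, hle ⟨i, rfl⟩⟩, rfl⟩) hsnd.isClosedEmbedding.isClosed_range
      (hdense b)
    exact ⟨a, hp⟩
  have huniq : ∀ {a b b'}, (a, b) ∈ Γ → (a, b') ∈ Γ → b = b' := fun {a b b'} h h' => by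
    have := hsub ⟨_, h⟩ ⟨_, h'⟩
    rw [sub_self, norm_zero] at this
    exact sub_eq_zero.1 (norm_eq_zero.1 this.symm)
  have huniq' : ∀ {a a' b}, (a, b) ∈ Γ → (a', b) ∈ Γ → a = a' := fun {a a' b} h h' => by
    have := hsub ⟨_, h⟩ ⟨_, h'⟩
    rw [sub_self, norm_zero] at this
    exact sub_eq_zero.1 (norm_eq_zero.1 this)
  choose u hu using fun a : I => (hA a).1 a.2
  choose v hv using hB
  let e : I ≃⋆ₐ[ℂ] B :=
    { toFun := u
      invFun := fun b => ⟨v b, (hA _).2 ⟨b, hv b⟩⟩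
      left_inv := fun a => Subtype.ext (huniq' (hv (u a)) (hu a))
      right_inv := fun b => huniq (hu ⟨v b, _⟩) (hv b)
      map_mul' := fun a b => huniq (hu (a * b)) (hΓmul _ (hu a) _ (hu b))
      map_add' := fun a b => huniq (hu (a + b)) (Γ.add_mem (hu a) (hu b))
      map_star' := fun a => huniq (hu (star a)) (hΓstar _ (hu a))
      map_smul' := fun c a => huniq (hu (c • a)) (Γ.smul_mem c (hu a)) }
  exact ⟨e, fun a => (hΓnorm _ (hu a)).symm, fun i h => huniq (hu ⟨α i, h⟩) (hle ⟨i, rfl⟩)⟩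

/-! ### The isomorphism -/

section BlockFunctions

variable {X : Type u} [TopologicalSpace X] {φ : Flow ℝ X} {S : Set X} {f g : C_c(ℝ, C(X, ℂ))}

theorem zero_mem_blockFunctions : (0 : C_c(ℝ, C(X, ℂ))) ∈ blockFunctions φ S := fun _ _ _ => rfl

theorem add_mem_blockFunctions (hf : f ∈ blockFunctions φ S) (hg : g ∈ blockFunctions φ S) :
    f + g ∈ blockFunctions φ S := fun x s h => by
  rw [CompactlySupportedContinuousMap.add_apply, ContinuousMap.add_apply, hf x s h, hg x s h,
    add_zero]

theorem smul_mem_blockFunctions (c : ℂ) (hf : f ∈ blockFunctions φ S) :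
    c • f ∈ blockFunctions φ S := fun x s h => by
  rw [CompactlySupportedContinuousMap.smul_apply, ContinuousMap.smul_apply, hf x s h, smul_zero]

end BlockFunctions

namespace IsCrossSection

variable {X : Type u} [TopologicalSpace X] [CompactSpace X] [T2Space X] {φ : Flow ℝ X}
  {S : Set X} (hS : IsCrossSection φ S) (hmin : IsMinimal φ)

set_option synthInstance.maxHeartbeats 400000 in
/-- Already the functions whose kernels on the cells are `g(y) a(t) b(s)`, with `a` and `b` vanishing
at the end points, have symbols that are total in `C(S, 𝕂)`. -/
theorem dense_image_symbol [CompactSpace S] [TotallyDisconnectedSpace S] :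
    Dense (hS.symbol hmin '' blockFunctions φ S) := by
  let R : Submodule ℂ C(S, compactOperators L2I) :=
    { carrier := hS.symbol hmin '' blockFunctions φ S
      add_mem' := by
        rintro _ _ ⟨f, hf, rfl⟩ ⟨g, hg, rfl⟩
        exact ⟨f + g, add_mem_blockFunctions hf hg, hS.symbol_add hmin f g⟩
      zero_mem' := ⟨0, zero_mem_blockFunctions, hS.symbol_zero hmin⟩
      smul_mem' := by
        rintro c _ ⟨f, hf, rfl⟩
        exact ⟨c • f, smul_mem_blockFunctions c hf, hS.symbol_smul hmin c f⟩ }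
  refine fun F => mem_of_elementaryField_mem (Q := R.topologicalClosure)
    R.isClosed_topologicalClosure (dense_span_compactRankOne dense_continuousVanishing) ?_ F
  rintro g _ ⟨v, hv, w, hw, rfl⟩
  obtain ⟨f, hf, h⟩ := hS.exists_symbol_eq_elementaryField hmin g hv hw
  exact R.le_topologicalClosure ⟨f, hf, h⟩

theorem norm_toCrossedProduct (φ : Flow ℝ X) (f : C_c(ℝ, C(X, ℂ))) :
    ‖toCrossedProduct φ f‖ = ‖universalRep φ f‖ := rfl

set_option synthInstance.maxHeartbeats 400000 in
/-- The symbol map extends to an isometric isomorphism on the closure of the block. -/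
theorem exists_starAlgEquiv_symbol [CompactSpace S] [TotallyDisconnectedSpace S] :
    ∃ e : blockAlgebra φ S ≃⋆ₐ[ℂ] C(S, compactOperators L2I), (∀ a, ‖e a‖ = ‖a‖) ∧
      ∀ (f : C_c(ℝ, C(X, ℂ))) (hf : f ∈ blockFunctions φ S),
        e (toBlockAlgebra φ S f hf) = hS.symbol hmin f := by
  have : ContinuousStar C(S, compactOperators L2I) :=
    ⟨ContinuousMap.continuous_postcomp starContinuousMap⟩
  have hI : (blockAlgebra φ S : Set (CrossedProduct φ)) =
      closure (range fun f : blockFunctions φ S => toCrossedProduct φ f) := by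
    rw [← image_eq_range]
    rfl
  have hdense : Dense (range fun f : blockFunctions φ S => hS.symbol hmin f) := by
    rw [← image_eq_range]
    exact hS.dense_image_symbol hmin
  obtain ⟨e, he, hef⟩ := exists_starAlgEquiv_of_norm_eq
    (fun f : blockFunctions φ S => toCrossedProduct φ f)
    (fun f : blockFunctions φ S => hS.symbol hmin f)
    ⟨⟨0, zero_mem_blockFunctions⟩, Subtype.ext (universalRep_zero φ), hS.symbol_zero hmin⟩
    (fun f g => ⟨⟨f + g, add_mem_blockFunctions f.2 g.2⟩,
      Subtype.ext (universalRep_add φ f g), hS.symbol_add hmin f g⟩)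
    (fun c f => ⟨⟨c • f, smul_mem_blockFunctions c f.2⟩,
      Subtype.ext (universalRep_smul φ c f), hS.symbol_smul hmin c f⟩)
    (fun f g => ⟨⟨conv φ f g, conv_mem_blockFunctions f.2 g.2⟩,
      Subtype.ext (universalRep_conv φ f g), hS.symbol_conv hmin f g.2⟩)
    (fun f => ⟨⟨invol φ f, invol_mem_blockFunctions f.2⟩,
      Subtype.ext (universalRep_invol φ f), hS.symbol_invol hmin f⟩)
    (fun f => (norm_toCrossedProduct φ f).trans (hS.norm_symbol hmin f.2).symm)
    (blockAlgebra φ S) hI hdense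
  exact ⟨e, he, fun f hf => hef ⟨f, hf⟩ _⟩

end IsCrossSection

end FlowAlg

theorem mainTheorem4 {X : Type u} [MetricSpace X] [CompactSpace X] (φ : Flow ℝ X)
    (hfree : IsFree φ) (hmin : IsMinimal φ) (x : X) (𝔅 : FlowboxStructure φ x)
    (h𝔅 : 𝔅.IsCantor) (n : ℕ) :
    (∀ y ∈ 𝔅.S n, IsLeast {t : ℝ | 0 < t ∧ φ t y ∈ 𝔅.S n} (arriveTime φ (𝔅.S n) y)) ∧
    ∃ e : blockAlgebra φ (𝔅.S n) ≃⋆ₐ[ℂ] C(𝔅.S n, compactOperators L2I),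
      (∀ a, IsLUB (range fun y => ‖e a y‖) ‖a‖) ∧
      ∀ (f : C_c(ℝ, C(X, ℂ))) (hf : f ∈ blockFunctions φ (𝔅.S n)) (y : 𝔅.S n) (ξ : L2I),
        ∀ᵐ t ∂((volume : Measure ℝ).restrict (Icc 0 1)),
          (e (toBlockAlgebra φ (𝔅.S n) f hf) y : L2I →L[ℂ] L2I) ξ t =
            ∫ s in Icc (0 : ℝ) 1,
              (arriveTime φ (𝔅.S n) y : ℂ) *
                f (arriveTime φ (𝔅.S n) y * (t - s)) (φ (arriveTime φ (𝔅.S n) y * t) y) * ξ s := by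
  obtain ⟨B, l, hB, -, ⟨c⟩, h⟩ := h𝔅
  obtain ⟨hsub, hclopen⟩ := h n
  have hne : (𝔅.S n).Nonempty :=
    (𝔅.isFlowbox n).centralSlice_nonempty ((𝔅.nonempty_interior n).mono interior_subset)
  have hS : IsCrossSection φ (𝔅.S n) := hB.isCrossSection hne hsub hclopen
  have : CompactSpace (𝔅.S n) := isCompact_iff_compactSpace.1 hS.isCompact
  have : Nonempty (𝔅.S n) := hne.to_subtype
  have : TotallyDisconnectedSpace (centralSlice φ B l) := c.symm.totallyDisconnectedSpace
  have : TotallyDisconnectedSpace (𝔅.S n) :=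
    ((Topology.IsEmbedding.inclusion (hsub.trans inter_subset_left)).isTotallyDisconnected_range).1
      (isTotallyDisconnected_of_totallyDisconnectedSpace _)
  refine ⟨fun y hy => hS.isLeast_arriveTime hmin hy, ?_⟩
  refine (hS.exists_starAlgEquiv_symbol hmin).imp fun e he =>
    ⟨fun a => ⟨?_, fun b hb => ?_⟩, fun f hf y ξ => ?_⟩
  · rintro _ ⟨y, rfl⟩
    exact ((e a).norm_coe_le_norm y).trans_eq (he.1 a)
  · rw [← he.1 a]
    obtain ⟨y⟩ := ‹Nonempty (𝔅.S n)›
    exact (ContinuousMap.norm_le _ ((norm_nonneg _).trans (hb ⟨y, rfl⟩))).2 fun y => hb ⟨y, rfl⟩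
  · rw [he.2 f hf]
    exact hS.isIntegralOp_sectionOp hmin f y ξ
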